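/- **Query lower bound for union volume estimation.** An *axis-aligned polygon* is a compact region of $\mathbb{R}^2$ bounded by a simple closed polygonal curve whose edges are all horizontal or vertical. Consider randomized adaptive algorithms that can access $n$ unknown objects $O_1,\dots,O_n\subset\mathbb{R}^2$ only by the following queries: (i) *volume*: given $i$, return $\mathrm{Vol}(O_i)$ (the area); (ii) *sampling*: given $i$, return a fresh, independent, uniformly distributed random point of $O_i$; (iii) *containment*: given $i$ and an arbitrary point $p\in\mathbb{R}^2$ (not necessarily a sampled one), return whether $p\in O_i$. The algorithm knows $n$ and $\varepsilon$; each next query, and the final output, may depend in an arbitrary (measurable) way on a random seed and on all answers received so far, without any bound on computation time or space. Put $V=\mathrm{Vol}(O_1\cup\dots\cup O_n)$; a *$(1+\varepsilon)$-approximation* of $V$ is a number $\rho\in[(1-\varepsilon)V,(1+\varepsilon)V]$. 1. There is an absolute constant $c>0$ such that for all $n\ge 2$, all $\varepsilon\in(0,1)$ and all integers $q\ge 0$: if an algorithm, on every sequence of $n$ axis-aligned polygons, outputs with probability at least $2/3$ a $(1+\varepsilon)$-approximation of $V$ after at most $q$ queries, then $q\ge c\,n/\varepsilon^2$. 2. The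 bound holds even if the algorithm only has to work for objects of equal volume, provided that $\varepsilon$ stays away from $1$: for every $\varepsilon_0<1$ there is a constant $c>0$, depending only on $\varepsilon_0$, such that for all $n\ge 2$, all $\varepsilon\in(0,\varepsilon_0]$ and all integers $q\ge 0$: if an algorithm, on every sequence of $n$ axis-aligned polygons that all have the same area, outputs with probability at least $2/3$ a $(1+\varepsilon)$-approximation of $V$ after at most $q$ queries, then $q\ge c\,n/\varepsilon^2$. -/

import Mathlib

open MeasureTheory ProbabilityTheory Set
open scoped ENNReal

noncomputable section

/-! ### Axis-aligned polygons in the plane -/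

/-- The closed polygonal curve with cyclic vertex sequence `p` is a simple closed curve: no edge is
degenerate, and two different edges have no point in common, except that two consecutive edges
share the vertex between them. -/
def Polygon.IsSimpleCurve {m : ℕ} (p : Polygon (ℝ × ℝ) m) : Prop :=
  p.HasNondegenerateEdges ∧
    ∀ i j : Fin m, i ≠ j → ∀ x ∈ p.edgeSet ℝ i ∩ p.edgeSet ℝ j,
      (j = finRotate m i ∧ x = p j) ∨ (i = finRotate m j ∧ x = p i)

/-- Every edge of `p` is horizontal or vertical. -/
def Polygon.HasAxisParallelEdges {m : ℕ} (p : Polygon (ℝ × ℝ) m) : Prop :=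
  ∀ i : Fin m, (p i).1 = (p (finRotate m i)).1 ∨ (p i).2 = (p (finRotate m i)).2

/-- `S` is an axis-aligned (simple, closed, solid) polygon in the plane: the compact region bounded
by a simple closed polygonal curve all of whose edges are horizontal or vertical. (By the Jordan
curve theorem, the curve together with its inside is the only compact set with nonempty interior
that has this curve as its frontier.) -/
def IsAxisAlignedPolygon (S : Set (ℝ × ℝ)) : Prop :=
  IsCompact S ∧ (interior S).Nonempty ∧
    ∃ (m : ℕ) (p : Polygon (ℝ × ℝ) m),
      p.IsSimpleCurve ∧ p.HasAxisParallelEdges ∧ frontier S = p.boundary ℝ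

/-- All sequences of `n` axis-aligned polygons. -/
def polygonInstances (n : ℕ) : Set (Fin n → Set (ℝ × ℝ)) :=
  {O | ∀ i, IsAxisAlignedPolygon (O i)}

/-- All sequences of `n` axis-aligned polygons of one and the same area. -/
def equiponderousPolygonInstances (n : ℕ) : Set (Fin n → Set (ℝ × ℝ)) :=
  {O | (∀ i, IsAxisAlignedPolygon (O i)) ∧ ∀ i j, volume (O i) = volume (O j)}

/-! ### The query model -/

/-- A query to the objects `O 0, …, O (n-1)`:
* `.inl i` asks for the volume of `O i`;
* `.inr (.inl i)` asks for a uniformly random point of `O i`;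
* `.inr (.inr (i, p))` asks whether the point `p` (any point of the plane) lies in `O i`. -/
abbrev Query (n : ℕ) : Type := Fin n ⊕ Fin n ⊕ (Fin n × (ℝ × ℝ))

/-- The answer to a query: a number (to a volume query), a point (to a sampling query) or a
truth value (to a containment query). -/
abbrev Answer : Type := ℝ ⊕ (ℝ × ℝ) ⊕ Prop

/-- The answer to a query about the objects `O`, if `x i` is the point that a sampling query to
`O i` returns at this moment. -/
def answer {n : ℕ} (O : Fin n → Set (ℝ × ℝ)) (x : Fin n → ℝ × ℝ) : Query n → Answer
  | .inl i => .inl (volume (O i)).toReal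
  | .inr (.inl i) => .inr (.inl (x i))
  | .inr (.inr (i, p)) => .inr (.inr (p ∈ O i))

/-- A randomized adaptive algorithm with random seed in `Ω`. After `t` queries it decides, in an
arbitrary (measurable) way from the seed and from the `t` answers received so far, either to make
a further query (`.inl`) or to stop and output a number (`.inr`). -/
structure QueryAlgorithm (Ω : Type*) [MeasurableSpace Ω] (n : ℕ) where
  act : (t : ℕ) → Ω × (Fin t → Answer) → Query n ⊕ ℝ
  measurable_act : ∀ t, Measurable (act t)

namespace QueryAlgorithm

variable {Ω : Type*} [MeasurableSpace Ω] {n : ℕ}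

/-- Continue `A` with seed `ω` on the objects `O` after the `t` answers `h`, for at most `q`
further queries; `x s i` is what the `s`-th of them returns if it is a sampling query to `O i`.
The result is the output of `A`, or `none` if `A` wants to make more than `q` further queries. -/
def runFrom (A : QueryAlgorithm Ω n) (O : Fin n → Set (ℝ × ℝ)) (ω : Ω) :
    (q : ℕ) → (t : ℕ) → (Fin t → Answer) → (Fin q → Fin n → ℝ × ℝ) → Option ℝ
  | 0, t, h, _ =>
    match A.act t (ω, h) with
    | .inl _ => none
    | .inr v => some v
  | q + 1, t, h, x =>
    match A.act t (ω, h) with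
    | .inl a => runFrom A O ω q (t + 1) (Fin.snoc h (answer O (x 0) a)) (Fin.tail x)
    | .inr v => some v

/-- The output of `A` on the objects `O`, or `none` if `A` makes more than `q` queries. -/
def run (A : QueryAlgorithm Ω n) (O : Fin n → Set (ℝ × ℝ)) (q : ℕ) (ω : Ω)
    (x : Fin q → Fin n → ℝ × ℝ) : Option ℝ :=
  A.runFrom O ω q 0 Fin.elim0 x

/-- The joint law of the seed and of the points returned by sampling queries: everything is
independent, and a sampling query to `O i` returns a uniformly distributed point of `O i`. -/
def runLaw (P : Measure Ω) (O : Fin n → Set (ℝ × ℝ)) (q : ℕ) :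
    Measure (Ω × (Fin q → Fin n → ℝ × ℝ)) :=
  P.prod (Measure.pi fun _ : Fin q => Measure.pi fun i : Fin n => cond volume (O i))

/-- With seed drawn from `P`, the algorithm `A` solves `(1 + ε)`-approximate union volume
estimation on all instances in `I` with `q` queries: with probability at least `2/3` it stops after
at most `q` queries with an output `ρ ∈ [(1 - ε) V, (1 + ε) V]`, where `V` is the volume of the
union. -/
def Solves (A : QueryAlgorithm Ω n) (P : Measure Ω) (ε : ℝ) (q : ℕ)
    (I : Set (Fin n → Set (ℝ × ℝ))) : Prop :=
  ∀ O ∈ I, (2 / 3 : ℝ≥0∞) ≤ runLaw P O q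
    {w | ∃ ρ : ℝ, A.run O q w.1 w.2 = some ρ ∧
      |ρ - (volume (⋃ i, O i)).toReal| ≤ ε * (volume (⋃ i, O i)).toReal}

end QueryAlgorithm

end

/-! Independent random bits are hidden in the objects in such a way that every answer depends on one
bit only. Under two product laws `p`, `p'` of the bits, the areas of the unions concentrate around
values so far apart that no output is correct for both. A successful algorithm therefore tells the
two laws apart, while each single bit carries little information.

The comparison is of chi-square type. For fixed randomness an algorithm is a decision tree on the
bits, and `sq_bitMean_hit_le` bounds the square of its acceptance probability under `p` by `K ^ q`
times that under `p'`, where `K` is the second-moment cost of one bit. Sampling fits this picture by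
a coupling: a raw point `z`, whose law does not depend on the bits, is carried to the object by a
measure preserving map `φ b i`. `sq_le_of_solves` averages over seed and raw points, and forces `K ^
q` to stay above an absolute constant larger than 1.

For `ε ≤ 1 / 128` the objects are combs with `N` columns, all of area `5 * N`. A bit decides whether
a column has bars `3, 2` or `4, 1`; turning it on moves one unit square inside that column. Object
`0` has all bits off, so a column of the union has area 6 if some other object has its bit on there,
and 5 otherwise. Bits are on with probability of order `1 / n`, and the two probabilities differ by
order `ε / n`. This changes the union by a relative amount of order `ε`, whereas `K - 1` is of order
`ε ^ 2 / n`; hence `le_queries_of_small_error`.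

For larger `ε` a bound linear in `n` is enough. All objects are the same unit square, unless a rare
bit replaces a block of them by rectangles that enlarge the union beyond the tolerance
(`le_queries_of_blocks`). With arbitrary areas a block is a single object that becomes tall. With
equal areas it consists of about `R` squares spread side by side, which is where the dependence on
`ε₀` comes from. -/

namespace UnionVolume

/-! ### Product Bernoulli weights on bit vectors -/

section Bits

variable {ι : Type*} [Fintype ι]

/-- The probability of the bit vector `b` if its bits are independent and bit `i` is `true` with
probability `p i`. -/
noncomputable def bitWeight (p : ι → ℝ) (b : ι → Bool) : ℝ :=
  ∏ i, if b i then p i else 1 - p i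

/-- The expectation of `f` under `bitWeight p`. -/
noncomputable def bitMean [DecidableEq ι] (p : ι → ℝ) (f : (ι → Bool) → ℝ) : ℝ :=
  ∑ b, bitWeight p b * f b

theorem bitWeight_nonneg {p : ι → ℝ} (hp : ∀ i, p i ∈ Icc (0 : ℝ) 1) (b : ι → Bool) :
    0 ≤ bitWeight p b := by
  refine Finset.prod_nonneg fun i _ => ?_
  have := hp i
  split_ifs <;> linarith [this.1, this.2]

variable [DecidableEq ι]

theorem sum_bitVec_prod {β : Type*} [Fintype β] (F : ι → β → ℝ) :
    ∑ b : ι → β, ∏ i, F i (b i) = ∏ i, ∑ v, F i v := by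
  rw [Finset.prod_univ_sum, Fintype.piFinset_univ]

theorem sum_bitWeight (p : ι → ℝ) : ∑ b, bitWeight p b = 1 := by
  unfold bitWeight
  rw [sum_bitVec_prod (fun i (v : Bool) => if v then p i else 1 - p i)]
  simp

theorem bitMean_const (p : ι → ℝ) (c : ℝ) : bitMean p (fun _ => c) = c := by
  unfold bitMean
  rw [← Finset.sum_mul, sum_bitWeight, one_mul]

theorem bitMean_mono {p : ι → ℝ} (hp : ∀ i, p i ∈ Icc (0 : ℝ) 1) {f g : (ι → Bool) → ℝ}
    (h : ∀ b, f b ≤ g b) : bitMean p f ≤ bitMean p g :=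
  Finset.sum_le_sum fun b _ => mul_le_mul_of_nonneg_left (h b) (bitWeight_nonneg hp b)

/-- Total probability over bit `j`. Conditioning is expressed by setting its probability to 1 or 0,
so the index type never changes. -/
theorem bitWeight_split (p : ι → ℝ) (j : ι) (b : ι → Bool) :
    bitWeight p b = p j * bitWeight (Function.update p j 1) b
      + (1 - p j) * bitWeight (Function.update p j 0) b := by
  have key : ∀ r : ι → ℝ, bitWeight r b = (if b j then r j else 1 - r j) *
      ∏ i ∈ Finset.univ.erase j, if b i then r i else 1 - r i := fun r =>
    (Finset.mul_prod_erase _ _ (Finset.mem_univ j)).symm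
  have same : ∀ v : ℝ, (∏ i ∈ Finset.univ.erase j,
      if b i then Function.update p j v i else 1 - Function.update p j v i)
        = ∏ i ∈ Finset.univ.erase j, if b i then p i else 1 - p i := fun v =>
    Finset.prod_congr rfl fun i hi => by
      rw [Function.update_of_ne (Finset.ne_of_mem_erase hi)]
  rw [key p, key, key, same, same]
  cases b j <;> simp

theorem bitMean_split (p : ι → ℝ) (j : ι) (f : (ι → Bool) → ℝ) :
    bitMean p f = p j * bitMean (Function.update p j 1) f
      + (1 - p j) * bitMean (Function.update p j 0) f := by
  unfold bitMean
  rw [Finset.mul_sum, Finset.mul_sum, ← Finset.sum_add_distrib]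
  refine Finset.sum_congr rfl fun b _ => ?_
  rw [bitWeight_split p j b]
  ring

theorem bitMean_congr_of_update_one (p : ι → ℝ) (j : ι) {f g : (ι → Bool) → ℝ}
    (h : ∀ b, b j = true → f b = g b) :
    bitMean (Function.update p j 1) f = bitMean (Function.update p j 1) g := by
  refine Finset.sum_congr rfl fun b _ => ?_
  cases hb : b j
  · have : bitWeight (Function.update p j 1) b = 0 :=
      Finset.prod_eq_zero (Finset.mem_univ j) (by simp [hb])
    simp [this]
  · rw [h b hb]

theorem bitMean_congr_of_update_zero (p : ι → ℝ) (j : ι) {f g : (ι → Bool) → ℝ}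
    (h : ∀ b, b j = false → f b = g b) :
    bitMean (Function.update p j 0) f = bitMean (Function.update p j 0) g := by
  refine Finset.sum_congr rfl fun b _ => ?_
  cases hb : b j
  · rw [h b hb]
  · have : bitWeight (Function.update p j 0) b = 0 :=
      Finset.prod_eq_zero (Finset.mem_univ j) (by simp [hb])
    simp [this]

end Bits

/-! ### Adaptive algorithms that learn one bit per query -/

/-- A bit that is `true` with probability `a` can be compared with a bit that is `true` with
probability `a'`, at the cost of a factor `K` in second moments. -/
def BitComparable (K a a' : ℝ) : Prop :=
  a ∈ Icc (0 : ℝ) 1 ∧ a' ∈ Icc (0 : ℝ) 1 ∧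
    ∀ x y : ℝ, (a * x + (1 - a) * y) ^ 2 ≤ K * (a' * x ^ 2 + (1 - a') * y ^ 2)

theorem bitComparable_one {K : ℝ} (hK : 1 ≤ K) : BitComparable K 1 1 :=
  ⟨by simp, by simp, fun x y => by nlinarith [sq_nonneg x]⟩

theorem bitComparable_zero {K : ℝ} (hK : 1 ≤ K) : BitComparable K 0 0 :=
  ⟨by simp, by simp, fun x y => by nlinarith [sq_nonneg y]⟩

/-- The indicator that `A`, continued for at most `q` further queries, stops with an output
in `E`. -/
noncomputable def hit {Ω : Type*} [MeasurableSpace Ω] {n : ℕ} (A : QueryAlgorithm Ω n) (E : Set ℝ)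
    (O : Fin n → Set (ℝ × ℝ)) (ω : Ω) (q t : ℕ) (h : Fin t → Answer)
    (x : Fin q → Fin n → ℝ × ℝ) : ℝ :=
  (some '' E).indicator 1 (A.runFrom O ω q t h x)

section Tree

variable {Ω Z ι : Type*} [MeasurableSpace Ω] [Fintype ι] [DecidableEq ι] {n : ℕ}

/-- Induction along the decision tree: a query reveals one bit `j`, comparability of its two
probabilities costs one factor `K`, and both branches continue with bit `j` fixed under either law.
A bit that has been revealed has probability 0 or 1 under both laws and stays comparable because `1
≤ K`, so repeated queries need no separate treatment. -/
theorem sq_bitMean_hit_le (A : QueryAlgorithm Ω n) (E : Set ℝ) (ω : Ω)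
    (O : (ι → Bool) → Fin n → Set (ℝ × ℝ)) (φ : (ι → Bool) → Fin n → Z → ℝ × ℝ)
    (hloc : ∀ (z : Fin n → Z) (a : Query n), ∃ j : ι, ∀ b b' : ι → Bool, b j = b' j →
      answer (O b) (fun i => φ b i (z i)) a = answer (O b') (fun i => φ b' i (z i)) a)
    {K : ℝ} (hK : 1 ≤ K) (q : ℕ) : ∀ (t : ℕ) (h : Fin t → Answer) (z : Fin q → Fin n → Z)
      (p p' : ι → ℝ), (∀ i, BitComparable K (p i) (p' i)) →
      (bitMean p fun b => hit A E (O b) ω q t h fun s i => φ b i (z s i)) ^ 2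
        ≤ K ^ q * bitMean p' fun b => hit A E (O b) ω q t h fun s i => φ b i (z s i) := by
  -- At a leaf the outcome no longer depends on the bits; a constant `c ∈ {0, 1}` satisfies `c ^ 2 =
  -- c`.
  have bound_of_const : ∀ (q t : ℕ) (h : Fin t → Answer) (z : Fin q → Fin n → Z) (p p' : ι → ℝ) (c : ℝ),
      (c = 0 ∨ c = 1) → (∀ b, hit A E (O b) ω q t h (fun s i => φ b i (z s i)) = c) →
      (bitMean p fun b => hit A E (O b) ω q t h fun s i => φ b i (z s i)) ^ 2
        ≤ K ^ q * bitMean p' fun b => hit A E (O b) ω q t h fun s i => φ b i (z s i) := by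
    intro q t h z p p' c hc hf
    simp only [hf, bitMean_const]
    have := one_le_pow₀ hK (n := q)
    rcases hc with rfl | rfl <;> simp [this]
  have ind : ∀ o : Option ℝ, (some '' E).indicator (1 : Option ℝ → ℝ) o = 0 ∨
      (some '' E).indicator (1 : Option ℝ → ℝ) o = 1 := fun o => by
    by_cases ho : o ∈ some '' E
    · exact .inr (by simp only [indicator_of_mem ho, Pi.one_apply])
    · exact .inl (indicator_of_notMem ho _)
  induction q with
  | zero =>
    intro t h z p p' _
    refine bound_of_const 0 t h z p p' _ (ind (match A.act t (ω, h) with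
      | .inl _ => none
      | .inr v => some v)) fun b => ?_
    rfl
  | succ q ih =>
    intro t h z p p' hp
    cases hact : A.act t (ω, h) with
    | inr v =>
      refine bound_of_const (q + 1) t h z p p' _ (ind (some v)) fun b => ?_
      rw [hit, QueryAlgorithm.runFrom, hact]
    | inl a =>
      obtain ⟨j, hj⟩ := hloc (z 0) a
      -- Only bit `j` matters for this answer, so a constant bit vector can represent either value.
      set ans : Bool → Answer := fun v =>
        answer (O fun _ => v) (fun i => φ (fun _ => v) i (z 0 i)) a with hans
      set F : Bool → (ι → Bool) → ℝ := fun v b =>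
        hit A E (O b) ω q (t + 1) (Fin.snoc h (ans v)) fun s i => φ b i (z s.succ i) with hF
      set f : (ι → Bool) → ℝ := fun b =>
        hit A E (O b) ω (q + 1) t h fun s i => φ b i (z s i) with hf
      have step : ∀ v b, b j = v → f b = F v b := by
        intro v b hb
        have hb' := hj b (fun _ => v) hb
        have hrun : A.runFrom (O b) ω (q + 1) t h (fun s i => φ b i (z s i))
            = A.runFrom (O b) ω q (t + 1) (Fin.snoc h (ans v)) (fun s i => φ b i (z s.succ i)) := by
          rw [QueryAlgorithm.runFrom, hact, hans]
          dsimp only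
          rw [hb']
          rfl
        simp only [hf, hF, hit, hrun]
      have comp : ∀ v : ℝ, (v = 0 ∨ v = 1) → ∀ i,
          BitComparable K (Function.update p j v i) (Function.update p' j v i) := by
        intro v hv i
        by_cases hi : i = j
        · subst hi
          rcases hv with rfl | rfl
          · simpa using bitComparable_zero hK
          · simpa using bitComparable_one hK
        · simpa [Function.update_of_ne hi] using hp i
      have h1 := ih (t + 1) (Fin.snoc h (ans true)) (fun s => z s.succ) _ _ (comp 1 (.inr rfl))
      have h0 := ih (t + 1) (Fin.snoc h (ans false)) (fun s => z s.succ) _ _ (comp 0 (.inl rfl))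
      rw [bitMean_split p j f, bitMean_split p' j f,
        bitMean_congr_of_update_one p j (step true), bitMean_congr_of_update_one p' j (step true),
        bitMean_congr_of_update_zero p j (step false),
        bitMean_congr_of_update_zero p' j (step false)]
      obtain ⟨-, ha', hle⟩ := hp j
      refine (hle _ _).trans ?_
      rw [pow_succ' K, mul_assoc]
      refine mul_le_mul_of_nonneg_left ?_ (by linarith)
      rw [mul_add]
      refine add_le_add ?_ ?_
      · rw [mul_left_comm]
        exact mul_le_mul_of_nonneg_left h1 ha'.1
      · rw [mul_left_comm]
        exact mul_le_mul_of_nonneg_left h0 (by linarith [ha'.2])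

end Tree

/-! ### Measurability of the run -/

section Measurability

variable {Ω : Type*} [MeasurableSpace Ω] {n : ℕ}

theorem measurable_answer {O : Fin n → Set (ℝ × ℝ)} (hO : ∀ i, MeasurableSet (O i)) :
    Measurable fun y : (Fin n → ℝ × ℝ) × Query n => answer O y.1 y.2 := by
  have e1 : Measurable fun y : (Fin n → ℝ × ℝ) × Fin n => answer O y.1 (.inl y.2) :=
    measurable_from_prod_countable_left fun i => by
      simpa only [answer] using measurable_const
  have e2 : Measurable fun y : (Fin n → ℝ × ℝ) × Fin n => answer O y.1 (.inr (.inl y.2)) :=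
    measurable_from_prod_countable_left fun i =>
      measurable_inr.comp (measurable_inl.comp (measurable_pi_apply i))
  have e3 : Measurable fun y : (Fin n → ℝ × ℝ) × (Fin n × (ℝ × ℝ)) =>
      answer O y.1 (.inr (.inr y.2)) := by
    have : Measurable fun y : Fin n × (ℝ × ℝ) => (y.2 ∈ O y.1 : Prop) :=
      measurable_from_prod_countable_right fun i => measurable_mem.2 (hO i)
    exact measurable_inr.comp (measurable_inr.comp (this.comp measurable_snd))
  have e23 : Measurable fun y : (Fin n → ℝ × ℝ) × (Fin n ⊕ (Fin n × (ℝ × ℝ))) =>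
      answer O y.1 (.inr y.2) := by
    refine (MeasurableEquiv.prodSumDistrib _ _ _).symm.measurable_comp_iff.1 ?_
    exact measurable_fun_sum e2 e3
  refine (MeasurableEquiv.prodSumDistrib _ _ _).symm.measurable_comp_iff.1 ?_
  exact measurable_fun_sum e1 e23

/-- A run either stops now with an output in `E`, or makes a query and succeeds from the measurable
successor state `G`. -/
theorem measurableSet_runFrom (A : QueryAlgorithm Ω n) {O : Fin n → Set (ℝ × ℝ)}
    (hO : ∀ i, MeasurableSet (O i)) {E : Set ℝ} (hE : MeasurableSet E) (q : ℕ) : ∀ t : ℕ,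
    MeasurableSet {w : Ω × (Fin t → Answer) × (Fin q → Fin n → ℝ × ℝ) |
      ∃ ρ ∈ E, A.runFrom O w.1 q t w.2.1 w.2.2 = some ρ} := by
  induction q with
  | zero =>
    intro t
    have : {w : Ω × (Fin t → Answer) × (Fin 0 → Fin n → ℝ × ℝ) |
        ∃ ρ ∈ E, A.runFrom O w.1 0 t w.2.1 w.2.2 = some ρ}
        = (fun w => A.act t (w.1, w.2.1)) ⁻¹' (Sum.inr '' E) := by
      ext w
      simp only [QueryAlgorithm.runFrom, mem_ofPred_eq, mem_preimage]
      cases A.act t (w.1, w.2.1) <;> simp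
    rw [this]
    exact ((A.measurable_act t).comp (by fun_prop)) hE.inr_image
  | succ q ih =>
    intro t
    have hact : Measurable fun w : Ω × (Fin t → Answer) × (Fin (q + 1) → Fin n → ℝ × ℝ) =>
        A.act t (w.1, w.2.1) := (A.measurable_act t).comp (by fun_prop)
    -- `nxt` needs a default query for states in which the algorithm stops; its value is cut off by
    -- the intersection with `range Sum.inl`. Without any query, every run stops at once.
    by_cases hQ : Nonempty (Query n)
    · obtain ⟨a₀⟩ := hQ
      set nxt : Query n ⊕ ℝ → Query n := Sum.elim id fun _ => a₀ with hnxt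
      have hnxt_m : Measurable nxt := measurable_id.sumElim measurable_const
      set G : Ω × (Fin t → Answer) × (Fin (q + 1) → Fin n → ℝ × ℝ) →
          Ω × (Fin (t + 1) → Answer) × (Fin q → Fin n → ℝ × ℝ) := fun w =>
        (w.1, Fin.snoc w.2.1 (answer O (w.2.2 0) (nxt (A.act t (w.1, w.2.1)))), Fin.tail w.2.2)
        with hG
      have hans : Measurable fun w : Ω × (Fin t → Answer) × (Fin (q + 1) → Fin n → ℝ × ℝ) =>
          answer O (w.2.2 0) (nxt (A.act t (w.1, w.2.1))) :=
        (measurable_answer hO).comp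
          (Measurable.prodMk (by fun_prop) (hnxt_m.comp hact))
      have hGm : Measurable G := by
        refine measurable_fst.prodMk (Measurable.prodMk ?_ ?_)
        · refine measurable_pi_iff.2 fun i => ?_
          refine Fin.lastCases ?_ (fun i => ?_) i
          · simpa using hans
          · simp only [Fin.snoc_castSucc]
            fun_prop
        · unfold Fin.tail
          fun_prop
      have : {w : Ω × (Fin t → Answer) × (Fin (q + 1) → Fin n → ℝ × ℝ) |
          ∃ ρ ∈ E, A.runFrom O w.1 (q + 1) t w.2.1 w.2.2 = some ρ}
          = (fun w => A.act t (w.1, w.2.1)) ⁻¹' (Sum.inr '' E) ∪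
            ((fun w => A.act t (w.1, w.2.1)) ⁻¹' (range Sum.inl) ∩
              G ⁻¹' {w | ∃ ρ ∈ E, A.runFrom O w.1 q (t + 1) w.2.1 w.2.2 = some ρ}) := by
        ext w
        simp only [QueryAlgorithm.runFrom, mem_ofPred_eq, mem_preimage, mem_union, mem_inter_iff,
          hG, hnxt]
        cases A.act t (w.1, w.2.1) <;> simp
      rw [this]
      exact (hact hE.inr_image).union ((hact measurableSet_range_inl).inter (hGm (ih (t + 1))))
    · have : {w : Ω × (Fin t → Answer) × (Fin (q + 1) → Fin n → ℝ × ℝ) |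
          ∃ ρ ∈ E, A.runFrom O w.1 (q + 1) t w.2.1 w.2.2 = some ρ}
          = (fun w => A.act t (w.1, w.2.1)) ⁻¹' (Sum.inr '' E) := by
        ext w
        simp only [QueryAlgorithm.runFrom, mem_ofPred_eq, mem_preimage]
        cases hc : A.act t (w.1, w.2.1) with
        | inl a => exact (hQ ⟨a⟩).elim
        | inr v => simp
      rw [this]
      exact hact hE.inr_image

theorem measurableSet_run (A : QueryAlgorithm Ω n) {O : Fin n → Set (ℝ × ℝ)}
    (hO : ∀ i, MeasurableSet (O i)) {E : Set ℝ} (hE : MeasurableSet E) (q : ℕ) :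
    MeasurableSet {w : Ω × (Fin q → Fin n → ℝ × ℝ) | ∃ ρ ∈ E, A.run O q w.1 w.2 = some ρ} := by
  have hm : Measurable fun w : Ω × (Fin q → Fin n → ℝ × ℝ) =>
      ((w.1, (Fin.elim0 : Fin 0 → Answer), w.2) :
        Ω × (Fin 0 → Answer) × (Fin q → Fin n → ℝ × ℝ)) :=
    measurable_fst.prodMk (measurable_const.prodMk measurable_snd)
  exact hm (measurableSet_runFrom A hO hE q 0)

end Measurability

/-! ### From decision trees to randomized algorithms -/

section Bound

variable {Ω Z ι : Type*} [MeasurableSpace Ω] [MeasurableSpace Z] [Fintype ι] [DecidableEq ι] {n : ℕ}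

theorem isProbabilityMeasure_of_measurePreserving {α β : Type*} [MeasurableSpace α]
    [MeasurableSpace β] {μ : Measure α} [IsProbabilityMeasure μ] {ν : Measure β} {f : α → β}
    (h : MeasurePreserving f μ ν) : IsProbabilityMeasure ν :=
  h.map_eq ▸ Measure.isProbabilityMeasure_map h.aemeasurable

/-- The coupling: raw samples `z` drawn from `m` become genuine samples of the objects, so different
instances can be run on the same source of randomness. -/
theorem measurePreserving_runLaw (P : Measure Ω) [IsProbabilityMeasure P]
    {O : Fin n → Set (ℝ × ℝ)} {m : Fin n → Measure Z} [∀ i, IsProbabilityMeasure (m i)]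
    {φ : Fin n → Z → ℝ × ℝ} (hφ : ∀ i, MeasurePreserving (φ i) (m i) (cond volume (O i))) (q : ℕ) :
    MeasurePreserving
      (Prod.map id fun (z : Fin q → Fin n → Z) s i => φ i (z s i))
      (P.prod (Measure.pi fun _ : Fin q => Measure.pi m)) (QueryAlgorithm.runLaw P O q) := by
  have hprob : ∀ i, IsProbabilityMeasure (cond volume (O i)) := fun i =>
    isProbabilityMeasure_of_measurePreserving (hφ i)
  have h1 : MeasurePreserving (fun (z : Fin n → Z) i => φ i (z i)) (Measure.pi m)
      (Measure.pi fun i => cond volume (O i)) := measurePreserving_pi _ _ hφ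
  have h2 : MeasurePreserving (fun (z : Fin q → Fin n → Z) s i => φ i (z s i))
      (Measure.pi fun _ => Measure.pi m)
      (Measure.pi fun _ : Fin q => Measure.pi fun i => cond volume (O i)) :=
    measurePreserving_pi _ _ fun _ => h1
  exact (MeasurePreserving.id P).prod h2

theorem hit_eq_indicator (A : QueryAlgorithm Ω n) (E : Set ℝ) (O : Fin n → Set (ℝ × ℝ)) (q : ℕ)
    (w : Ω × (Fin q → Fin n → ℝ × ℝ)) :
    hit A E O w.1 q 0 Fin.elim0 w.2
      = {w : Ω × (Fin q → Fin n → ℝ × ℝ) | ∃ ρ ∈ E, A.run O q w.1 w.2 = some ρ}.indicator 1 w := by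
  unfold hit
  by_cases h : ∃ ρ ∈ E, A.run O q w.1 w.2 = some ρ
  · rw [indicator_of_mem (by obtain ⟨ρ, hρ, h⟩ := h; exact ⟨ρ, hρ, h.symm⟩),
      indicator_of_mem (show w ∈ {w : Ω × (Fin q → Fin n → ℝ × ℝ) |
        ∃ ρ ∈ E, A.run O q w.1 w.2 = some ρ} from h)]
    rfl
  · rw [indicator_of_notMem (by rintro ⟨ρ, hρ, h'⟩; exact h ⟨ρ, hρ, h'.symm⟩),
      indicator_of_notMem (show w ∉ {w : Ω × (Fin q → Fin n → ℝ × ℝ) |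
        ∃ ρ ∈ E, A.run O q w.1 w.2 = some ρ} from h)]

/-- If `E` separates the correct outputs on most of the instances drawn with bit probabilities `p`
from those on most of the instances drawn with bit probabilities `p'`, and if each answer depends
on a single bit, then an algorithm that solves all the instances makes many queries. -/
theorem sq_le_of_solves {P : Measure Ω} [IsProbabilityMeasure P]
    {A : QueryAlgorithm Ω n} {ε : ℝ} {q : ℕ} {I : Set (Fin n → Set (ℝ × ℝ))}
    (hA : A.Solves P ε q I) {O : (ι → Bool) → Fin n → Set (ℝ × ℝ)} (hOI : ∀ b, O b ∈ I)
    (hOm : ∀ b i, MeasurableSet (O b i)) {m : Fin n → Measure Z}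
    [hprob : ∀ i, IsProbabilityMeasure (m i)] {φ : (ι → Bool) → Fin n → Z → ℝ × ℝ}
    (hφ : ∀ b i, MeasurePreserving (φ b i) (m i) (cond volume (O b i)))
    (hloc : ∀ (z : Fin n → Z) (a : Query n), ∃ j : ι, ∀ b b' : ι → Bool, b j = b' j →
      answer (O b) (fun i => φ b i (z i)) a = answer (O b') (fun i => φ b' i (z i)) a)
    {K : ℝ} (hK : 1 ≤ K) {p p' : ι → ℝ} (hp : ∀ i, BitComparable K (p i) (p' i))
    {E : Set ℝ} (hE : MeasurableSet E) {G G' : Set (ι → Bool)}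
    (hG : ∀ b ∈ G, ∀ ρ : ℝ, |ρ - (volume (⋃ i, O b i)).toReal|
      ≤ ε * (volume (⋃ i, O b i)).toReal → ρ ∈ E)
    (hG' : ∀ b ∈ G', ∀ ρ : ℝ, |ρ - (volume (⋃ i, O b i)).toReal|
      ≤ ε * (volume (⋃ i, O b i)).toReal → ρ ∉ E)
    {η : ℝ} (hη : η ≤ 1) (hpG : 1 - η ≤ bitMean p (G.indicator 1))
    (hpG' : 1 - η ≤ bitMean p' (G'.indicator 1)) :
    (2 / 3 * (1 - η)) ^ 2 ≤ K ^ q * (1 / 3 + η) := by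
  set μ := P.prod (Measure.pi fun _ : Fin q => Measure.pi m) with hμ
  set Ψ : (ι → Bool) → Ω × (Fin q → Fin n → Z) → Ω × (Fin q → Fin n → ℝ × ℝ) := fun b =>
    Prod.map id fun z s i => φ b i (z s i) with hΨ
  have hΨm : ∀ b, MeasurePreserving (Ψ b) μ (QueryAlgorithm.runLaw P (O b) q) := fun b =>
    measurePreserving_runLaw P (hφ b) q
  have hlaw : ∀ b, IsProbabilityMeasure (QueryAlgorithm.runLaw P (O b) q) := fun b =>
    isProbabilityMeasure_of_measurePreserving (hΨm b)
  set S : (ι → Bool) → Set (Ω × (Fin q → Fin n → ℝ × ℝ)) := fun b =>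
    {w | ∃ ρ ∈ E, A.run (O b) q w.1 w.2 = some ρ} with hS
  have hSm : ∀ b, MeasurableSet (S b) := fun b => measurableSet_run A (hOm b) hE q
  set r : (ι → Bool) → ℝ := fun b => (QueryAlgorithm.runLaw P (O b) q).real (S b) with hr
  have hgood : ∀ b, (2 / 3 : ℝ) ≤ (QueryAlgorithm.runLaw P (O b) q).real
      {w | ∃ ρ : ℝ, A.run (O b) q w.1 w.2 = some ρ ∧ |ρ - (volume (⋃ i, O b i)).toReal|
        ≤ ε * (volume (⋃ i, O b i)).toReal} := by
    intro b
    have := ENNReal.toReal_mono (measure_ne_top _ _) (hA (O b) (hOI b))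
    simpa [Measure.real] using this
  have hr_G : ∀ b ∈ G, 2 / 3 ≤ r b := fun b hb =>
    (hgood b).trans (measureReal_mono (by
      rintro w ⟨ρ, hw, hρ⟩
      exact ⟨ρ, hG b hb ρ hρ, hw⟩))
  have hr_G' : ∀ b ∈ G', r b ≤ 1 / 3 := by
    intro b hb
    have h1 : (QueryAlgorithm.runLaw P (O b) q).real (S b)ᶜ = 1 - r b :=
      probReal_compl_eq_one_sub (hSm b)
    have h2 := (hgood b).trans (measureReal_mono (s₂ := (S b)ᶜ) (by
      rintro w ⟨ρ, hw, hρ⟩ ⟨ρ', hρ', hw'⟩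
      rw [hw] at hw'
      cases hw'
      exact hG' b hb ρ hρ hρ') (measure_ne_top _ _))
    linarith
  set f : (ι → Bool) → Ω × (Fin q → Fin n → Z) → ℝ := fun b w =>
    hit A E (O b) w.1 q 0 Fin.elim0 fun s i => φ b i (w.2 s i) with hf
  have hf_ind : ∀ b, f b = (Ψ b ⁻¹' S b).indicator 1 := fun b => by
    funext w
    exact hit_eq_indicator A E (O b) q (Ψ b w)
  have hSm' : ∀ b, MeasurableSet (Ψ b ⁻¹' S b) := fun b => (hΨm b).measurable (hSm b)
  have hf_int : ∀ b, Integrable (f b) μ := fun b => by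
    rw [hf_ind]
    exact (integrable_const (1 : ℝ)).indicator (hSm' b)
  have hf_val : ∀ b, ∫ w, f b w ∂μ = r b := fun b => by
    rw [hf_ind, integral_indicator_one (hSm' b), hr]
    simp only [Measure.real, (hΨm b).measure_preimage (hSm b).nullMeasurableSet]
  have hmean_int : ∀ s : ι → ℝ, Integrable (fun w => bitMean s fun b => f b w) μ := fun s =>
    integrable_finsetSum _ fun b _ => (hf_int b).const_mul _
  have hmean : ∀ s : ι → ℝ, ∫ w, bitMean s (fun b => f b w) ∂μ = bitMean s r := fun s => by
    unfold bitMean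
    rw [integral_finsetSum _ fun b _ => (hf_int b).const_mul _]
    exact Finset.sum_congr rfl fun b _ => by rw [integral_const_mul, hf_val]
  have hpw : ∀ w, (bitMean p fun b => f b w) ^ 2 ≤ K ^ q * bitMean p' fun b => f b w := fun w =>
    sq_bitMean_hit_le A E w.1 O φ hloc hK q 0 Fin.elim0 w.2 p p' hp
  have hK' : (0 : ℝ) ≤ K ^ q := by positivity
  -- Jensen's inequality for the square, in the tangent form `X ^ 2 ≥ 2 * c * X - c ^ 2` with `c`
  -- the mean of `X`.
  have main : bitMean p r ^ 2 ≤ K ^ q * bitMean p' r := by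
    have := integral_mono (((hmean_int p).const_mul (2 * bitMean p r)).sub
      (integrable_const (bitMean p r ^ 2))) ((hmean_int p').const_mul (K ^ q)) (fun w => by
        have := hpw w
        dsimp only [Pi.sub_apply]
        nlinarith [sq_nonneg (bitMean p (fun b => f b w) - bitMean p r)])
    simp only [Pi.sub_apply] at this
    rw [integral_sub ((hmean_int p).const_mul _) (integrable_const _), integral_const_mul,
      integral_const_mul, hmean, hmean] at this
    simp only [integral_const, probReal_univ, smul_eq_mul] at this
    linarith
  have hp01 : ∀ i, p i ∈ Icc (0 : ℝ) 1 := fun i => (hp i).1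
  have hp01' : ∀ i, p' i ∈ Icc (0 : ℝ) 1 := fun i => (hp i).2.1
  have lower : 2 / 3 * (1 - η) ≤ bitMean p r := by
    have h1 : bitMean p (fun b => 2 / 3 * G.indicator 1 b) = 2 / 3 * bitMean p (G.indicator 1) := by
      unfold bitMean
      rw [Finset.mul_sum]
      exact Finset.sum_congr rfl fun b _ => by ring
    have h2 : bitMean p (fun b => 2 / 3 * G.indicator 1 b) ≤ bitMean p r := by
      refine bitMean_mono hp01 fun b => ?_
      by_cases hb : b ∈ G
      · simpa [hb] using hr_G b hb
      · simp [hb, hr]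
    linarith
  have upper : bitMean p' r ≤ 1 / 3 + η := by
    have h1 : bitMean p' (fun b => 1 - 2 / 3 * G'.indicator 1 b)
        = 1 - 2 / 3 * bitMean p' (G'.indicator 1) := by
      have h0 := sum_bitWeight p'
      unfold bitMean
      simp only [mul_sub, mul_one, Finset.sum_sub_distrib, h0, Finset.mul_sum]
      congr 1
      exact Finset.sum_congr rfl fun b _ => by ring
    have h2 : bitMean p' r ≤ bitMean p' (fun b => 1 - 2 / 3 * G'.indicator 1 b) := by
      refine bitMean_mono hp01' fun b => ?_
      by_cases hb : b ∈ G'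
      · have := hr_G' b hb
        simp only [hb, indicator_of_mem, Pi.one_apply]
        linarith
      · simpa [hb] using measureReal_le_one
    -- With `hpG'` this gives `0 ≤ η`, which is needed to round `1 - 2 / 3 * (1 - η)` up to `1 / 3 +
    -- η`.
    have h3 : bitMean p' (G'.indicator 1) ≤ 1 := by
      refine (bitMean_mono hp01' (g := fun _ => 1) fun b => ?_).trans_eq (bitMean_const p' 1)
      exact indicator_le_self' (fun _ _ => zero_le_one) b
    linarith
  calc (2 / 3 * (1 - η)) ^ 2 ≤ bitMean p r ^ 2 :=
        pow_le_pow_left₀ (by linarith) lower 2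
    _ ≤ K ^ q * bitMean p' r := main
    _ ≤ _ := mul_le_mul_of_nonneg_left upper hK'

end Bound

open Filter Topology

/-! ### Histogram polygons -/

/-- The region under the histogram that has height `g (k + 1)` over the interval
`[x k, x (k + 1)]`, for `k < L`. -/
def histogram (x g : ℕ → ℝ) (L : ℕ) : Set (ℝ × ℝ) :=
  {z | 0 ≤ z.2 ∧ ∃ k < L, x k ≤ z.1 ∧ z.1 ≤ x (k + 1) ∧ z.2 ≤ g (k + 1)}

/-- The breakpoints `x` increase, the heights `g` are positive over the bars and vanish outside,
and neighbouring bars have different heights. -/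
structure IsProfile (x g : ℕ → ℝ) (L : ℕ) : Prop where
  length_pos : 0 < L
  strictMono : StrictMono x
  left : g 0 = 0
  right : g (L + 1) = 0
  pos : ∀ k < L, 0 < g (k + 1)
  ne : ∀ k, k + 1 < L → g (k + 1) ≠ g (k + 2)

/-- The outline of a histogram. -/
def histogramCurve (x g : ℕ → ℝ) (L : ℕ) : Polygon (ℝ × ℝ) (2 * L + 2) :=
  ⟨fun j => (x (j / 2), g ((j + 1) / 2))⟩

theorem mem_segment_vertical {a b c : ℝ} {z : ℝ × ℝ} :
    z ∈ segment ℝ (a, b) (a, c) ↔ z.1 = a ∧ z.2 ∈ uIcc b c := by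
  rw [← Prod.image_mk_segment_right, segment_eq_uIcc]
  constructor
  · rintro ⟨y, hy, rfl⟩
    exact ⟨rfl, hy⟩
  · rintro ⟨rfl, h⟩
    exact ⟨z.2, h, rfl⟩

theorem mem_segment_horizontal {a b c : ℝ} {z : ℝ × ℝ} :
    z ∈ segment ℝ (a, c) (b, c) ↔ z.2 = c ∧ z.1 ∈ uIcc a b := by
  rw [← Prod.image_mk_segment_left, segment_eq_uIcc]
  constructor
  · rintro ⟨y, hy, rfl⟩
    exact ⟨rfl, hy⟩
  · rintro ⟨rfl, h⟩
    exact ⟨z.1, h, rfl⟩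

section Curve

variable {x g : ℕ → ℝ} {L : ℕ}

theorem finRotate_val_of_lt {m : ℕ} (j : Fin (m + 1)) (h : (j : ℕ) < m) :
    (finRotate (m + 1) j : ℕ) = j + 1 := by
  rw [coe_finRotate_of_ne_last]
  rintro rfl
  simp at h

theorem finRotate_val_of_eq {m : ℕ} (j : Fin (m + 1)) (h : (j : ℕ) = m) :
    (finRotate (m + 1) j : ℕ) = 0 := by
  obtain rfl : j = Fin.last m := Fin.ext h
  simp

/-- The two roundings in `histogramCurve` advance alternately: from vertex `2 * k` only the height
index grows (a wall), from `2 * k + 1` only the breakpoint index (the top of a bar). Edge `2 * L +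
1` closes the curve along the base. -/
theorem mem_edge_even (j : Fin (2 * L + 2)) {k : ℕ} (_hk : k ≤ L) (hj : (j : ℕ) = 2 * k)
    (z : ℝ × ℝ) :
    z ∈ (histogramCurve x g L).edgeSet ℝ j ↔ z.1 = x k ∧ z.2 ∈ uIcc (g k) (g (k + 1)) := by
  have h1 : (finRotate (2 * L + 2) j : ℕ) = 2 * k + 1 := by
    rw [finRotate_val_of_lt _ (by omega), hj]
  have e1 : 2 * k / 2 = k := by omega
  have e2 : (2 * k + 1) / 2 = k := by omega
  have e3 : (2 * k + 1 + 1) / 2 = k + 1 := by omega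
  rw [Polygon.edgeSet, affineSegment_eq_segment]
  simp only [histogramCurve, hj, h1, e1, e2, e3, mem_segment_vertical]

theorem mem_edge_odd (hx : StrictMono x) (j : Fin (2 * L + 2)) {k : ℕ} (hk : k < L)
    (hj : (j : ℕ) = 2 * k + 1) (z : ℝ × ℝ) :
    z ∈ (histogramCurve x g L).edgeSet ℝ j ↔ z.2 = g (k + 1) ∧ x k ≤ z.1 ∧ z.1 ≤ x (k + 1) := by
  have h1 : (finRotate (2 * L + 2) j : ℕ) = 2 * k + 2 := by
    rw [finRotate_val_of_lt _ (by omega), hj]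
  have e1 : (2 * k + 1) / 2 = k := by omega
  have e2 : (2 * k + 1 + 1) / 2 = k + 1 := by omega
  have e3 : (2 * k + 2 + 1) / 2 = k + 1 := by omega
  rw [Polygon.edgeSet, affineSegment_eq_segment]
  simp only [histogramCurve, hj, h1, e1, e2, e3, mem_segment_horizontal,
    uIcc_of_le (hx.monotone (Nat.le_succ k)), mem_Icc]

theorem mem_edge_last (h : IsProfile x g L) (j : Fin (2 * L + 2)) (hj : (j : ℕ) = 2 * L + 1)
    (z : ℝ × ℝ) :
    z ∈ (histogramCurve x g L).edgeSet ℝ j ↔ z.2 = 0 ∧ x 0 ≤ z.1 ∧ z.1 ≤ x L := by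
  have h1 : (finRotate (2 * L + 2) j : ℕ) = 0 := finRotate_val_of_eq _ hj
  have e1 : (2 * L + 1) / 2 = L := by omega
  have e2 : (2 * L + 1 + 1) / 2 = L + 1 := by omega
  rw [Polygon.edgeSet, affineSegment_eq_segment]
  simp only [histogramCurve, hj, h1, e1, e2, h.right, zero_add,
    show 1 / 2 = 0 from rfl, h.left, mem_segment_horizontal,
    uIcc_of_ge (h.strictMono.monotone (Nat.zero_le L)), mem_Icc]

theorem even_or_odd_or_last (j : Fin (2 * L + 2)) :
    (∃ k ≤ L, (j : ℕ) = 2 * k) ∨ (∃ k < L, (j : ℕ) = 2 * k + 1) ∨ (j : ℕ) = 2 * L + 1 := by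
  have := j.isLt
  rcases Nat.even_or_odd' (j : ℕ) with ⟨k, hk | hk⟩
  · exact .inl ⟨k, by omega, hk⟩
  · by_cases h : k < L
    · exact .inr (.inl ⟨k, h, hk⟩)
    · exact .inr (.inr (by omega))

theorem IsProfile.ne_succ (h : IsProfile x g L) {k : ℕ} (hk : k ≤ L) : g k ≠ g (k + 1) := by
  have hL := h.length_pos
  rcases Nat.eq_zero_or_pos k with rfl | hk0
  · rw [h.left]
    exact (h.pos 0 hL).ne
  · obtain ⟨k, rfl⟩ : ∃ l, k = l + 1 := ⟨k - 1, by omega⟩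
    rcases hk.lt_or_eq with hk | rfl
    · exact h.ne k hk
    · rw [h.right]
      exact (h.pos k (by omega)).ne'

theorem IsProfile.nonneg (h : IsProfile x g L) {k : ℕ} (hk : k ≤ L + 1) : 0 ≤ g k := by
  rcases Nat.eq_zero_or_pos k with rfl | hk0
  · rw [h.left]
  · obtain ⟨k, rfl⟩ : ∃ l, k = l + 1 := ⟨k - 1, by omega⟩
    rcases hk.lt_or_eq with hk | hk
    · exact (h.pos k (by omega)).le
    · rw [hk, h.right]

/-- Walls have distinct abscissas, consecutive tops have distinct heights, and positive heights keep
the inner walls and the tops off the base. Only contacts at shared vertices remain. -/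
theorem IsProfile.edge_inter (h : IsProfile x g L) {i j : Fin (2 * L + 2)} (hij : i < j)
    {z : ℝ × ℝ} (hi : z ∈ (histogramCurve x g L).edgeSet ℝ i)
    (hj : z ∈ (histogramCurve x g L).edgeSet ℝ j) :
    (j = finRotate _ i ∧ z = histogramCurve x g L j) ∨
      (i = finRotate _ j ∧ z = histogramCurve x g L i) := by
  have hx := h.strictMono
  have hij' : (i : ℕ) < j := hij
  have next : (j : ℕ) = i + 1 → j = finRotate _ i := fun e =>
    Fin.ext (by rw [finRotate_val_of_lt _ (by have := j.isLt; omega), e])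
  rcases even_or_odd_or_last i with ⟨k, hk, ik⟩ | ⟨k, hk, ik⟩ | il
  · rw [mem_edge_even i hk ik] at hi
    rcases even_or_odd_or_last j with ⟨l, hl, jl⟩ | ⟨l, hl, jl⟩ | jl
    · rw [mem_edge_even j hl jl] at hj
      exact absurd (hi.1.symm.trans hj.1) (hx.injective.ne (by omega))
    · rw [mem_edge_odd hx j hl jl] at hj
      have : l ≤ k := hx.le_iff_le.1 (hi.1 ▸ hj.2.1)
      obtain rfl : l = k := by omega
      refine .inl ⟨next (by omega), Prod.ext ?_ ?_⟩
      · simpa [histogramCurve, jl, show (2 * l + 1) / 2 = l by omega] using hi.1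
      · simpa [histogramCurve, jl, show (2 * l + 1 + 1) / 2 = l + 1 by omega] using hj.1
    · rw [mem_edge_last h j jl] at hj
      rcases Nat.eq_zero_or_pos k with rfl | hk0
      · refine .inr ⟨Fin.ext (by rw [finRotate_val_of_eq _ jl]; exact ik), Prod.ext ?_ ?_⟩
        · simpa [histogramCurve, ik] using hi.1
        · simpa [histogramCurve, ik, h.left] using hj.1
      · rcases hk.lt_or_eq with hkL | rfl
        · have h1 := h.pos k hkL
          have h2 := h.pos (k - 1) (by omega)
          rw [Nat.sub_add_cancel hk0] at h2
          have := hi.2.1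
          rw [hj.1] at this
          exact absurd this (not_le.2 (lt_min h2 h1))
        · refine .inl ⟨next (by omega), Prod.ext ?_ ?_⟩
          · simpa [histogramCurve, jl, show (2 * k + 1) / 2 = k by omega] using hi.1
          · simpa [histogramCurve, jl, show (2 * k + 1 + 1) / 2 = k + 1 by omega, h.right]
              using hj.1
  · rw [mem_edge_odd hx i hk ik] at hi
    rcases even_or_odd_or_last j with ⟨l, hl, jl⟩ | ⟨l, hl, jl⟩ | jl
    · rw [mem_edge_even j hl jl] at hj
      have : l ≤ k + 1 := hx.le_iff_le.1 (hj.1 ▸ hi.2.2)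
      obtain rfl : l = k + 1 := by omega
      refine .inl ⟨next (by omega), Prod.ext ?_ ?_⟩
      · simpa [histogramCurve, jl] using hj.1
      · simpa [histogramCurve, jl, show (2 * (k + 1) + 1) / 2 = k + 1 by omega] using hi.1
    · rw [mem_edge_odd hx j hl jl] at hj
      have : l ≤ k + 1 := hx.le_iff_le.1 (hj.2.1.trans hi.2.2)
      obtain rfl : l = k + 1 := by omega
      exact absurd (hi.1.symm.trans hj.1) (h.ne k (by omega))
    · rw [mem_edge_last h j jl] at hj
      exact absurd (hi.1.symm.trans hj.1) (h.pos k hk).ne'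
  · have := j.isLt
    omega

theorem IsProfile.isSimpleCurve (h : IsProfile x g L) : (histogramCurve x g L).IsSimpleCurve := by
  refine ⟨fun j => ?_, fun i j hij z hz => ?_⟩
  · have hx := h.strictMono
    rcases even_or_odd_or_last j with ⟨k, hk, jk⟩ | ⟨k, hk, jk⟩ | jl
    · have h1 := finRotate_val_of_lt j (by omega)
      intro e
      have := congrArg Prod.snd e
      simp only [histogramCurve, jk, h1, show (2 * k + 1) / 2 = k by omega,
        show (2 * k + 1 + 1) / 2 = k + 1 by omega] at this
      exact h.ne_succ hk this
    · have h1 := finRotate_val_of_lt j (by omega)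
      intro e
      have := congrArg Prod.fst e
      simp only [histogramCurve, jk, h1, show (2 * k + 1) / 2 = k by omega,
        show (2 * k + 1 + 1) / 2 = k + 1 by omega] at this
      exact hx.injective.ne (Nat.succ_ne_self k).symm this
    · have h1 := finRotate_val_of_eq j jl
      intro e
      have := congrArg Prod.fst e
      simp only [histogramCurve, jl, h1, show (2 * L + 1) / 2 = L by omega,
        Nat.zero_div] at this
      exact hx.injective.ne h.length_pos.ne' this
  · rcases lt_or_gt_of_ne hij with hlt | hlt
    · exact h.edge_inter hlt hz.1 hz.2
    · exact (h.edge_inter hlt hz.2 hz.1).symm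

theorem IsProfile.hasAxisParallelEdges (h : IsProfile x g L) :
    (histogramCurve x g L).HasAxisParallelEdges := by
  intro j
  rcases even_or_odd_or_last j with ⟨k, hk, jk⟩ | ⟨k, hk, jk⟩ | jl
  · have h1 := finRotate_val_of_lt j (by omega)
    left
    simp only [histogramCurve, jk, h1]
    congr 1
    omega
  · have h1 := finRotate_val_of_lt j (by omega)
    right
    simp only [histogramCurve, jk, h1]
    congr 1
    omega
  · have h1 := finRotate_val_of_eq j jl
    right
    simp only [histogramCurve, jl, h1, show (2 * L + 1 + 1) / 2 = L + 1 by omega, zero_add,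
      show 1 / 2 = 0 from rfl, h.left, h.right]

theorem histogram_eq_biUnion : histogram x g L =
    ⋃ k ∈ Finset.range L, Icc (x k) (x (k + 1)) ×ˢ Icc 0 (g (k + 1)) := by
  ext z
  simp only [histogram, mem_ofPred_eq, mem_iUnion, Finset.mem_range, mem_prod, mem_Icc, exists_prop]
  constructor
  · rintro ⟨h0, k, hk, h1, h2, h3⟩
    exact ⟨k, hk, ⟨h1, h2⟩, h0, h3⟩
  · rintro ⟨k, hk, ⟨h1, h2⟩, h0, h3⟩
    exact ⟨h0, k, hk, h1, h2, h3⟩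

theorem isCompact_histogram : IsCompact (histogram x g L) := by
  rw [histogram_eq_biUnion]
  exact (Finset.range L).isCompact_biUnion fun k _ => isCompact_Icc.prod isCompact_Icc

theorem mem_interior_of_box {S : Set (ℝ × ℝ)} {z : ℝ × ℝ} {a b c : ℝ} (ha : a < z.1)
    (hb : z.1 < b) (h0 : 0 < z.2) (hc : z.2 < c)
    (hS : ∀ y : ℝ × ℝ, a < y.1 → y.1 < b → 0 < y.2 → y.2 < c → y ∈ S) : z ∈ interior S :=
  mem_interior.2 ⟨Ioo a b ×ˢ Ioo 0 c, fun y hy => hS y hy.1.1 hy.1.2 hy.2.1 hy.2.2,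
    isOpen_Ioo.prod isOpen_Ioo, ⟨⟨ha, hb⟩, h0, hc⟩⟩

/-- Off the curve, the point is strictly above the base and strictly below its top. If it lies over
a breakpoint, then avoiding the wall forces it below both adjacent bars, and a box across the two
bars surrounds it. -/
theorem IsProfile.mem_interior (h : IsProfile x g L) {z : ℝ × ℝ} (hz : z ∈ histogram x g L)
    (hb : z ∉ (histogramCurve x g L).boundary ℝ) : z ∈ interior (histogram x g L) := by
  have hx := h.strictMono
  obtain ⟨h0, k, hk, h1, h2, h3⟩ := hz
  have hbd : ∀ j, z ∉ (histogramCurve x g L).edgeSet ℝ j := fun j hj =>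
    hb (mem_iUnion.2 ⟨j, hj⟩)
  have vert : ∀ l, l ≤ L → z.1 = x l → z.2 ∉ uIcc (g l) (g (l + 1)) := fun l hl hz hz' =>
    hbd ⟨2 * l, by omega⟩ ((mem_edge_even _ hl rfl z).2 ⟨hz, hz'⟩)
  have hpos : 0 < z.2 := by
    refine h0.lt_of_ne' fun e => hbd ⟨2 * L + 1, by omega⟩ ((mem_edge_last h _ rfl z).2
      ⟨e, (hx.monotone (Nat.zero_le k)).trans h1, h2.trans (hx.monotone hk)⟩)
  have hlt : z.2 < g (k + 1) := by
    refine h3.lt_of_ne fun e => hbd ⟨2 * k + 1, by omega⟩ ((mem_edge_odd hx _ hk rfl z).2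
      ⟨e, h1, h2⟩)
  have break_pt : ∀ l, l + 1 < L → z.1 = x (l + 1) → z.2 < g (l + 1) → z.2 < g (l + 2) →
      z ∈ interior (histogram x g L) := by
    intro l hl hz hz1 hz2
    refine mem_interior_of_box (a := x l) (b := x (l + 2)) (c := min (g (l + 1)) (g (l + 2)))
      (hz ▸ hx (by omega)) (hz ▸ hx (by omega)) hpos (lt_min hz1 hz2) fun y ha hb hy hc => ?_
    rcases le_total y.1 (x (l + 1)) with hle | hle
    · exact ⟨hy.le, l, by omega, ha.le, hle, (hc.trans_le (min_le_left _ _)).le⟩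
    · exact ⟨hy.le, l + 1, hl, hle, hb.le, (hc.trans_le (min_le_right _ _)).le⟩
  rcases h1.lt_or_eq with h1' | h1'
  · rcases h2.lt_or_eq with h2' | h2'
    · exact mem_interior_of_box h1' h2' hpos hlt fun y ha hb hy hc =>
        ⟨hy.le, k, hk, ha.le, hb.le, hc.le⟩
    · have hv := vert (k + 1) hk h2'
      have hlt' : z.2 < g (k + 2) := by
        by_contra hcon
        exact hv (mem_uIcc.2 (.inr ⟨not_lt.1 hcon, hlt.le⟩))
      rcases (Nat.succ_le_of_lt hk).lt_or_eq with hk' | hk'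
      · exact break_pt k hk' h2' hlt hlt'
      · have : g (k + 2) = 0 := by rw [show k + 2 = L + 1 by omega, h.right]
        linarith
  · have hv := vert k hk.le h1'.symm
    have hlt' : z.2 < g k := by
      by_contra hcon
      exact hv (mem_uIcc.2 (.inl ⟨not_lt.1 hcon, hlt.le⟩))
    rcases Nat.eq_zero_or_pos k with rfl | hk0
    · rw [h.left] at hlt'
      linarith
    · obtain ⟨l, rfl⟩ : ∃ l, k = l + 1 := ⟨k - 1, by omega⟩
      exact break_pt l hk h1'.symm hlt' hlt

theorem notMem_interior_of_path {S : Set (ℝ × ℝ)} {z : ℝ × ℝ} (u v : ℝ) {δ : ℝ} (hδ : 0 < δ)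
    (hS : ∀ t : ℝ, 0 < t → t < δ → (z.1 + t * u, z.2 + t * v) ∉ S) : z ∉ interior S := by
  intro hz
  have hc : Tendsto (fun t : ℝ => (z.1 + t * u, z.2 + t * v)) (𝓝[>] 0) (𝓝 z) := by
    have : Continuous fun t : ℝ => (z.1 + t * u, z.2 + t * v) := by fun_prop
    have := this.tendsto 0
    simp only [zero_mul, add_zero] at this
    exact this.mono_left nhdsWithin_le_nhds
  have h1 : ∀ᶠ t : ℝ in 𝓝[>] 0, (z.1 + t * u, z.2 + t * v) ∈ S :=
    hc (mem_interior_iff_mem_nhds.1 hz)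
  have h2 : ∀ᶠ t : ℝ in 𝓝[>] 0, t ∈ Ioo 0 δ := Ioo_mem_nhdsGT hδ
  obtain ⟨t, ht1, ht2⟩ := (h1.and h2).exists
  exact hS t ht2.1 ht2.2 ht1

theorem IsProfile.edge_subset (h : IsProfile x g L) (j : Fin (2 * L + 2)) :
    (histogramCurve x g L).edgeSet ℝ j ⊆ histogram x g L := by
  have hx := h.strictMono
  have hL := h.length_pos
  intro z hz
  rcases even_or_odd_or_last j with ⟨k, hk, jk⟩ | ⟨k, hk, jk⟩ | jl
  · rw [mem_edge_even j hk jk] at hz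
    have h0 : 0 ≤ z.2 := (le_min (h.nonneg (by omega)) (h.nonneg (by omega))).trans hz.2.1
    refine ⟨h0, ?_⟩
    by_cases hcase : k < L ∧ z.2 ≤ g (k + 1)
    · exact ⟨k, hcase.1, hz.1.ge, hz.1.trans_le (hx.monotone (Nat.le_succ k)), hcase.2⟩
    · have hle : z.2 ≤ g k := by
        rcases le_max_iff.1 hz.2.2 with h1 | h1
        · exact h1
        · have : k = L := by
            by_contra hne
            exact hcase ⟨by omega, h1⟩
          subst this
          rw [h.right] at h1
          exact h1.trans (h.nonneg (by omega))
      rcases Nat.eq_zero_or_pos k with rfl | hk0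
      · rw [h.left] at hle
        exact absurd ⟨hL, hle.trans (h.pos 0 hL).le⟩ hcase
      · obtain ⟨l, rfl⟩ : ∃ l, k = l + 1 := ⟨k - 1, by omega⟩
        exact ⟨l, by omega, hz.1.ge.trans' (hx.monotone (Nat.le_succ l)), hz.1.le, hle⟩
  · rw [mem_edge_odd hx j hk jk] at hz
    exact ⟨hz.1 ▸ (h.pos k hk).le, k, hk, hz.2.1, hz.2.2, hz.1.le⟩
  · rw [mem_edge_last h j jl] at hz
    refine ⟨hz.1.ge, ?_⟩
    have : ∃ k < L, x k ≤ z.1 ∧ z.1 ≤ x (k + 1) := by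
      have key : ∀ M, 0 < M → z.1 ≤ x M → ∃ k < M, x k ≤ z.1 ∧ z.1 ≤ x (k + 1) := by
        intro M
        induction M with
        | zero => intro h; omega
        | succ M ih =>
          intro _ hM
          rcases le_total (x M) z.1 with hle | hle
          · exact ⟨M, by omega, hle, hM⟩
          · rcases Nat.eq_zero_or_pos M with rfl | hM0
            · exact ⟨0, by omega, hz.2.1, hM⟩
            · obtain ⟨k, hk, h'⟩ := ih hM0 hle
              exact ⟨k, by omega, h'⟩
      exact key L hL hz.2.2
    obtain ⟨k, hk, h1, h2⟩ := this
    exact ⟨k, hk, h1, h2, hz.1.le.trans (h.pos k hk).le⟩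

theorem segment_subset_of_openSegment_subset {F : Set (ℝ × ℝ)} (hF : IsClosed F) {a b : ℝ × ℝ}
    (h : openSegment ℝ a b ⊆ F) : segment ℝ a b ⊆ F :=
  segment_subset_closure_openSegment.trans (closure_minimal h hF)

theorem IsProfile.edge_subset_frontier (h : IsProfile x g L) (j : Fin (2 * L + 2)) :
    (histogramCurve x g L).edgeSet ℝ j ⊆ frontier (histogram x g L) := by
  have hx := h.strictMono
  have hclosed : IsClosed (histogram x g L) := isCompact_histogram.isClosed
  have hsub := h.edge_subset j
  -- Escape from the region goes sideways over the lower neighbour of a wall, upwards from a top,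
  -- downwards from the base. Corners are left out, since the sideways escape fails at the foot of a
  -- wall; they follow because the frontier is closed.
  have not_int : ∀ z ∈ openSegment ℝ (histogramCurve x g L j)
      (histogramCurve x g L (finRotate _ j)), z ∉ interior (histogram x g L) := by
    intro z hz
    rcases even_or_odd_or_last j with ⟨k, hk, jk⟩ | ⟨k, hk, jk⟩ | jl
    · have h1 := finRotate_val_of_lt j (by omega)
      obtain ⟨a, b, ha, hb, hab, rfl⟩ := hz
      have hne := h.ne_succ hk
      simp only [histogramCurve, jk, h1, show 2 * k / 2 = k by omega,
        show (2 * k + 1) / 2 = k by omega, show (2 * k + 1 + 1) / 2 = k + 1 by omega,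
        Prod.smul_mk, smul_eq_mul, Prod.mk_add_mk]
      obtain rfl : a = 1 - b := by linarith
      rw [show (1 - b) * x k + b * x k = x k by ring]
      rcases lt_or_gt_of_ne hne with hlt | hlt
      · rcases Nat.eq_zero_or_pos k with rfl | hk0
        · refine notMem_interior_of_path (-1) 0 one_pos fun t ht _ => ?_
          rintro ⟨-, l, hl, hl1, -⟩
          have := hx.monotone (Nat.zero_le l)
          dsimp only at hl1
          linarith
        · obtain ⟨m, rfl⟩ : ∃ m, k = m + 1 := ⟨k - 1, by omega⟩
          refine notMem_interior_of_path (-1) 0 (sub_pos.2 (hx (Nat.lt_succ_self m)))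
            fun t ht ht' => ?_
          rintro ⟨-, l, hl, hl1, hl2, hl3⟩
          dsimp only at hl1 hl2 hl3
          have i1 : l < m + 1 := hx.lt_iff_lt.1 (by linarith)
          have i2 : m < l + 1 := hx.lt_iff_lt.1 (by linarith)
          obtain rfl : l = m := by omega
          nlinarith
      · refine notMem_interior_of_path 1 0 (sub_pos.2 (hx (Nat.lt_succ_self k)))
          fun t ht ht' => ?_
        rintro ⟨-, l, hl, hl1, hl2, hl3⟩
        dsimp only at hl1 hl2 hl3
        have i1 : l < k + 1 := hx.lt_iff_lt.1 (by linarith)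
        have i2 : k < l + 1 := hx.lt_iff_lt.1 (by linarith)
        obtain rfl : l = k := by omega
        nlinarith
    · have h1 := finRotate_val_of_lt j (by omega)
      obtain ⟨a, b, ha, hb, hab, rfl⟩ := hz
      simp only [histogramCurve, jk, h1, show (2 * k + 1) / 2 = k by omega,
        show (2 * k + 1 + 1) / 2 = k + 1 by omega,
        show (2 * k + 1 + 1 + 1) / 2 = k + 1 by omega, Prod.smul_mk, smul_eq_mul, Prod.mk_add_mk]
      obtain rfl : a = 1 - b := by linarith
      have hk' := hx (Nat.lt_succ_self k)
      refine notMem_interior_of_path 0 1 one_pos fun t ht _ => ?_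
      rintro ⟨-, l, hl, hl1, hl2, hl3⟩
      dsimp only [Nat.succ_eq_add_one] at hl1 hl2 hl3 hk'
      have i1 : l < k + 1 := hx.lt_iff_lt.1 (by nlinarith)
      have i2 : k < l + 1 := hx.lt_iff_lt.1 (by nlinarith)
      obtain rfl : l = k := by omega
      linarith
    · have hz' := openSegment_subset_segment ℝ _ _ hz
      rw [← affineSegment_eq_segment] at hz'
      have hz0 := ((mem_edge_last h j jl z).1 hz').1
      refine notMem_interior_of_path 0 (-1) one_pos fun t ht _ => ?_
      rintro ⟨h0, -⟩
      dsimp only at h0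
      linarith
  rw [Polygon.edgeSet, affineSegment_eq_segment] at hsub ⊢
  refine segment_subset_of_openSegment_subset isClosed_frontier fun z hz => ?_
  rw [hclosed.frontier_eq]
  exact ⟨hsub (openSegment_subset_segment ℝ _ _ hz), not_int z hz⟩

theorem IsProfile.isAxisAlignedPolygon (h : IsProfile x g L) :
    IsAxisAlignedPolygon (histogram x g L) := by
  have hx := h.strictMono
  have hL := h.length_pos
  refine ⟨isCompact_histogram, ⟨((x 0 + x 1) / 2, g 1 / 2), ?_⟩,
    2 * L + 2, histogramCurve x g L, h.isSimpleCurve, h.hasAxisParallelEdges, ?_⟩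
  · have h1 := hx (Nat.zero_lt_one)
    have h2 := h.pos 0 hL
    rw [zero_add] at h2
    exact mem_interior_of_box (a := x 0) (b := x 1) (c := g 1) (by dsimp only; linarith)
      (by dsimp only; linarith) (by dsimp only; linarith) (by dsimp only; linarith)
      fun y ha hb hy hc => ⟨hy.le, 0, hL, ha.le, hb.le, hc.le⟩
  · refine Subset.antisymm (fun z hz => ?_) (iUnion_subset h.edge_subset_frontier)
    rw [isCompact_histogram.isClosed.frontier_eq] at hz
    by_contra hb
    exact hz.2 (h.mem_interior hz.1 hb)

end Curve

/-! ### Areas and uniform distributions -/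

theorem ae_fst_notMem {C : Set ℝ} (hC : C.Countable) : ∀ᵐ z : ℝ × ℝ, z.1 ∉ C := by
  have : {z : ℝ × ℝ | ¬ z.1 ∉ C} = C ×ˢ univ := by
    ext z
    simp
  rw [ae_iff, this, Measure.volume_eq_prod, Measure.prod_prod, hC.measure_zero, zero_mul]

/-- Closed bars meet only over breakpoints, a null set; half-open bars are disjoint and their areas
add. -/
theorem volume_histogram {x : ℕ → ℝ} (hx : StrictMono x) (g : ℕ → ℝ) (L : ℕ) :
    volume (histogram x g L)
      = ∑ k ∈ Finset.range L, ENNReal.ofReal (x (k + 1) - x k) * ENNReal.ofReal (g (k + 1)) := by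
  have hae : histogram x g L =ᵐ[volume]
      ⋃ k ∈ Finset.range L, Ico (x k) (x (k + 1)) ×ˢ Icc 0 (g (k + 1)) := by
    filter_upwards [ae_fst_notMem (countable_range x)] with z hz
    rw [histogram_eq_biUnion]
    refine propext ?_
    change z ∈ (⋃ k ∈ Finset.range L, Icc (x k) (x (k + 1)) ×ˢ Icc 0 (g (k + 1))) ↔
      z ∈ (⋃ k ∈ Finset.range L, Ico (x k) (x (k + 1)) ×ˢ Icc 0 (g (k + 1)))
    simp only [mem_iUnion, exists_prop, mem_prod, mem_Icc, mem_Ico]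
    refine exists_congr fun k => and_congr_right fun _ => and_congr_left fun _ =>
      and_congr_right fun _ => ⟨fun h => h.lt_of_ne fun e => hz ⟨k + 1, e.symm⟩, le_of_lt⟩
  rw [measure_congr hae, measure_biUnion_finset]
  · refine Finset.sum_congr rfl fun k _ => ?_
    rw [Measure.volume_eq_prod, Measure.prod_prod, Real.volume_Ico, Real.volume_Icc, sub_zero]
  · intro k _ l _ hkl
    refine Set.disjoint_left.2 fun z hk hl => hkl ?_
    have h1 : k < l + 1 := hx.lt_iff_lt.1 (hk.1.1.trans_lt hl.1.2)
    have h2 : l < k + 1 := hx.lt_iff_lt.1 (hl.1.1.trans_lt hk.1.2)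
    omega
  · exact fun k _ => measurableSet_Ico.prod measurableSet_Icc

theorem measurePreserving_cond {α : Type*} [MeasurableSpace α] {μ : Measure α} {f : α → α}
    (hf : MeasurePreserving f μ μ) {S M : Set α} (hS : MeasurableSet S)
    (hM : f ⁻¹' S =ᵐ[μ] M) : MeasurePreserving f (cond μ M) (cond μ S) := by
  have h1 : MeasurePreserving f (μ.restrict M) (μ.restrict S) := by
    rw [← Measure.restrict_congr_set hM]
    exact hf.restrict_preimage hS
  have h2 : μ M = μ S := by
    rw [← measure_congr hM, hf.measure_preimage hS.nullMeasurableSet]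
  refine ⟨hf.measurable, ?_⟩
  rw [ProbabilityTheory.cond, ProbabilityTheory.cond, Measure.map_smul, h1.map_eq, h2]

open Classical in
/-- The map that exchanges `A` and its translate `A + v`, and fixes all other points. -/
noncomputable def swapMap (A : Set (ℝ × ℝ)) (v z : ℝ × ℝ) : ℝ × ℝ :=
  if z ∈ A then z + v else if z - v ∈ A then z - v else z

theorem measurable_swapMap {A : Set (ℝ × ℝ)} (hA : MeasurableSet A) (v : ℝ × ℝ) :
    Measurable (swapMap A v) := by
  have hB : MeasurableSet {z : ℝ × ℝ | z - v ∈ A} := (measurable_id.sub_const v) hA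
  exact Measurable.ite hA (by fun_prop) (Measurable.ite hB (by fun_prop) measurable_id)

/-- By `hv`, the set `A` and its translate are disjoint. The map is a translation on each of them
and the identity elsewhere. -/
theorem measurePreserving_swapMap {A : Set (ℝ × ℝ)} (hA : MeasurableSet A) {v : ℝ × ℝ}
    (hv : ∀ z ∈ A, z - v ∉ A) : MeasurePreserving (swapMap A v) volume volume := by
  refine ⟨measurable_swapMap hA v, Measure.ext fun s hs => ?_⟩
  set B : Set (ℝ × ℝ) := {z | z - v ∈ A} with hB
  have hBm : MeasurableSet B := (measurable_id.sub_const v) hA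
  have dA : ∀ z ∈ A, z ∉ B := hv
  have split : ∀ t : Set (ℝ × ℝ), volume t
      = volume (t ∩ A) + (volume (t ∩ B) + volume (t ∩ Aᶜ ∩ Bᶜ)) := fun t => by
    rw [← measure_inter_add_sdiff t hA, ← measure_inter_add_sdiff (t \ A) hBm]
    congr 2
    congr 1
    ext z
    exact ⟨fun h => ⟨h.1.1, h.2⟩, fun h => ⟨⟨h.1, fun h' => dA z h' h.2⟩, h.2⟩⟩
  rw [Measure.map_apply (measurable_swapMap hA v) hs, split, split s]
  have e1 : swapMap A v ⁻¹' s ∩ A = (fun z => z + v) ⁻¹' (s ∩ B) := by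
    ext z
    simp only [mem_inter_iff, mem_preimage, hB, mem_ofPred_eq, add_sub_cancel_right]
    refine and_congr_left fun h => ?_
    rw [swapMap, if_pos h]
  have e2 : swapMap A v ⁻¹' s ∩ B = (fun z => z + -v) ⁻¹' (s ∩ A) := by
    ext z
    simp only [mem_inter_iff, mem_preimage, hB, mem_ofPred_eq, ← sub_eq_add_neg]
    refine and_congr_left fun h => ?_
    rw [swapMap, if_neg fun h' => dA z h' h, if_pos h]
  have e3 : swapMap A v ⁻¹' s ∩ Aᶜ ∩ Bᶜ = s ∩ Aᶜ ∩ Bᶜ := by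
    ext z
    simp only [mem_inter_iff, mem_preimage, mem_compl_iff]
    refine and_congr_left fun h2 => and_congr_left fun h1 => ?_
    rw [swapMap, if_neg h1, if_neg (show ¬ z - v ∈ A from h2)]
  rw [e1, e2, e3, measure_preimage_add_right, measure_preimage_add_right]
  ring

/-! ### Combs -/

/-- The heights of a histogram that has `N` columns, each consisting of a left bar of height `l c`
and a right bar of height `r c`. -/
noncomputable def combHeight (l r : ℕ → ℝ) (N k : ℕ) : ℝ :=
  if k = 0 ∨ 2 * N < k then 0 else if Even k then r (k / 2 - 1) else l (k / 2)

/-- The histogram over `[0, 2 * N]` whose bars have width `1` and alternately the heights `l c`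
and `r c`. -/
noncomputable def comb (l r : ℕ → ℝ) (N : ℕ) : Set (ℝ × ℝ) :=
  histogram (fun k => (k : ℝ)) (combHeight l r N) (2 * N)

section Comb

variable {l r : ℕ → ℝ} {N : ℕ}

theorem combHeight_left {c : ℕ} (hc : c < N) : combHeight l r N (2 * c + 1) = l c := by
  rw [combHeight, if_neg (by omega), if_neg (by simp), show (2 * c + 1) / 2 = c by omega]

theorem combHeight_right {c : ℕ} (hc : c < N) : combHeight l r N (2 * c + 2) = r c := by
  rw [combHeight, if_neg (by omega), if_pos ⟨c + 1, by omega⟩,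
    show (2 * c + 2) / 2 - 1 = c by omega]

theorem strictMono_natCast : StrictMono fun k : ℕ => (k : ℝ) := Nat.strictMono_cast

/-- The gap between 2 and 3 keeps neighbouring bars of different height, inside a column and across
columns. -/
theorem isAxisAlignedPolygon_comb (hN : 0 < N) (hl : ∀ c, 3 ≤ l c) (hr : ∀ c, r c ≤ 2)
    (hr' : ∀ c, 1 ≤ r c) : IsAxisAlignedPolygon (comb l r N) := by
  refine IsProfile.isAxisAlignedPolygon ⟨by omega, strictMono_natCast, ?_, ?_, ?_, ?_⟩
  · simp [combHeight]
  · simp [combHeight]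
  · intro k hk
    rcases Nat.even_or_odd' k with ⟨c, rfl | rfl⟩
    · rw [combHeight_left (by omega)]
      linarith [hl c]
    · rw [combHeight_right (by omega)]
      linarith [hr' c]
  · intro k hk
    rcases Nat.even_or_odd' k with ⟨c, rfl | rfl⟩
    · rw [combHeight_left (by omega), combHeight_right (by omega)]
      have := hl c
      have := hr c
      intro h
      linarith
    · rw [combHeight_right (by omega), show 2 * c + 1 + 2 = 2 * (c + 1) + 1 by ring,
        combHeight_left (by omega)]
      have := hl (c + 1)
      have := hr c
      intro h
      linarith

theorem measurableSet_comb : MeasurableSet (comb l r N) :=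
  isCompact_histogram.isClosed.measurableSet

theorem mem_comb {z : ℝ × ℝ} : z ∈ comb l r N ↔ 0 ≤ z.2 ∧ ∃ c < N,
    (2 * (c : ℝ) ≤ z.1 ∧ z.1 ≤ 2 * c + 1 ∧ z.2 ≤ l c) ∨
      (2 * (c : ℝ) + 1 ≤ z.1 ∧ z.1 ≤ 2 * c + 2 ∧ z.2 ≤ r c) := by
  refine and_congr_right fun _ => ⟨?_, ?_⟩
  · rintro ⟨k, hk, h1, h2, h3⟩
    rcases Nat.even_or_odd' k with ⟨c, rfl | rfl⟩
    · rw [combHeight_left (by omega)] at h3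
      push_cast at h1 h2
      exact ⟨c, by omega, .inl ⟨h1, h2, h3⟩⟩
    · rw [combHeight_right (by omega)] at h3
      push_cast at h1 h2
      exact ⟨c, by omega, .inr ⟨h1, by linarith, h3⟩⟩
  · rintro ⟨c, hc, ⟨h1, h2, h3⟩ | ⟨h1, h2, h3⟩⟩
    · refine ⟨2 * c, by omega, ?_, ?_, ?_⟩
      · push_cast; exact h1
      · push_cast; exact h2
      · rwa [combHeight_left hc]
    · refine ⟨2 * c + 1, by omega, ?_, ?_, ?_⟩
      · push_cast; exact h1
      · push_cast; linarith
      · rwa [combHeight_right hc]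

theorem sum_range_two_mul {M : Type*} [AddCommMonoid M] (F : ℕ → M) (N : ℕ) :
    ∑ k ∈ Finset.range (2 * N), F k = ∑ c ∈ Finset.range N, (F (2 * c) + F (2 * c + 1)) := by
  induction N with
  | zero => simp
  | succ N ih =>
    rw [show 2 * (N + 1) = 2 * N + 1 + 1 by ring, Finset.sum_range_succ, Finset.sum_range_succ, ih,
      Finset.sum_range_succ, add_assoc]

theorem volume_comb (hl : ∀ c, 0 ≤ l c) (hr : ∀ c, 0 ≤ r c) :
    volume (comb l r N) = ENNReal.ofReal (∑ c ∈ Finset.range N, (l c + r c)) := by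
  rw [comb, volume_histogram strictMono_natCast, sum_range_two_mul,
    ENNReal.ofReal_sum_of_nonneg fun c _ => add_nonneg (hl c) (hr c)]
  refine Finset.sum_congr rfl fun c hc => ?_
  have hc' := Finset.mem_range.1 hc
  rw [combHeight_left hc', combHeight_right hc', ENNReal.ofReal_add (hl c) (hr c)]
  simp

end Comb

/-! ### Combs with hidden bits -/

/-- Height of the left bar in a column with bit `v`. -/
noncomputable def leftHeight (v : Bool) : ℝ := if v then 4 else 3

/-- Height of the right bar in a column with bit `v`. -/
noncomputable def rightHeight (v : Bool) : ℝ := if v then 1 else 2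

/-- The comb whose column `c` has the bars `3, 2` if `β c` is `false`, and `4, 1` if it is
`true`. -/
noncomputable def bitComb (β : ℕ → Bool) (N : ℕ) : Set (ℝ × ℝ) :=
  comb (fun c => leftHeight (β c)) (fun c => rightHeight (β c)) N

/-- The part of the right bars that is missing in the columns with bit `true`. -/
def movedPart (β : ℕ → Bool) (N : ℕ) : Set (ℝ × ℝ) :=
  ⋃ c ∈ {c | c < N ∧ β c = true}, Ico (2 * (c : ℝ) + 1) (2 * c + 2) ×ˢ Ioc 1 2

/-- A volume preserving map that transforms the comb with bits `false` into the one with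
bits `β`. -/
noncomputable def bitMap (β : ℕ → Bool) (N : ℕ) : ℝ × ℝ → ℝ × ℝ :=
  swapMap (movedPart β N) (-1, 2)

section BitComb

variable {β β' : ℕ → Bool} {N : ℕ}

theorem mem_movedPart {z : ℝ × ℝ} : z ∈ movedPart β N ↔ ∃ c < N, β c = true ∧
    2 * (c : ℝ) + 1 ≤ z.1 ∧ z.1 < 2 * c + 2 ∧ 1 < z.2 ∧ z.2 ≤ 2 := by
  simp only [movedPart, mem_iUnion, mem_ofPred_eq, mem_prod, mem_Ico, mem_Ioc, exists_prop,
    and_assoc]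

theorem measurableSet_movedPart : MeasurableSet (movedPart β N) :=
  MeasurableSet.biUnion (to_countable _) fun _ _ => measurableSet_Ico.prod measurableSet_Ioc

theorem leftHeight_mem (v : Bool) : 3 ≤ leftHeight v ∧ leftHeight v ≤ 4 := by
  cases v <;> norm_num [leftHeight]

theorem rightHeight_mem (v : Bool) : 1 ≤ rightHeight v ∧ rightHeight v ≤ 2 := by
  cases v <;> norm_num [rightHeight]

theorem isAxisAlignedPolygon_bitComb (hN : 0 < N) : IsAxisAlignedPolygon (bitComb β N) :=
  isAxisAlignedPolygon_comb hN (fun _ => (leftHeight_mem _).1) (fun _ => (rightHeight_mem _).2)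
    fun _ => (rightHeight_mem _).1

/-- `3 + 2 = 4 + 1`: volume queries reveal nothing about the bits. -/
theorem volume_bitComb : volume (bitComb β N) = ENNReal.ofReal (5 * N) := by
  rw [bitComb, volume_comb (fun c => by linarith [(leftHeight_mem (β c)).1])
    (fun c => by linarith [(rightHeight_mem (β c)).1])]
  have : ∀ v, leftHeight v + rightHeight v = 5 := by
    intro v
    cases v <;> norm_num [leftHeight, rightHeight]
  simp [this, mul_comm]

theorem mem_bitComb_iff_of_notMem_range {z : ℝ × ℝ} (hz : z.1 ∉ range fun k : ℕ => (k : ℝ)) :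
    bitMap β N z ∈ bitComb β N ↔ z ∈ bitComb (fun _ => false) N := by
  have hne : ∀ k : ℕ, z.1 ≠ k := fun k e => hz ⟨k, e.symm⟩
  unfold bitMap swapMap
  simp only [bitComb, mem_comb]
  -- The square at heights `(1, 2]` of a right bar is exchanged with the one at heights `(3, 4]`
  -- over the left bar. The cases are: a point of the former, a point of the latter (outside the
  -- all-`false` comb), a fixed point.
  split_ifs with hA hB
  · obtain ⟨c, hc, hβ, h1, h2, h3, h4⟩ := mem_movedPart.1 hA
    refine iff_of_true ⟨?_, c, hc, .inl ⟨?_, ?_, ?_⟩⟩ ⟨?_, c, hc, .inr ⟨h1, h2.le, ?_⟩⟩ <;>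
      norm_num [hβ, leftHeight, rightHeight] <;> linarith
  · obtain ⟨c, hc, hβ, h1, h2, h3, h4⟩ := mem_movedPart.1 hB
    simp only [Prod.fst_sub, Prod.snd_sub] at h1 h2 h3 h4
    -- Strictness matters: for `z.1 = 2 * c` the image would lie on the closed right wall of left
    -- bar `c`, hence inside the comb.
    have h1' : 2 * (c : ℝ) < z.1 := by
      refine lt_of_le_of_ne (by linarith) ?_
      have := (hne (2 * c)).symm
      push_cast at this
      exact this
    refine iff_of_false ?_ ?_
    · rintro ⟨-, c', hc', ⟨i1, i2, i3⟩ | ⟨i1, i2, i3⟩⟩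
      · simp only [Prod.fst_sub] at i1 i2
        have j1 : c' < c + 1 := by
          have : (c' : ℝ) < c + 1 := by linarith
          exact_mod_cast this
        have j2 : c < c' := by
          have : (c : ℝ) < c' := by linarith
          exact_mod_cast this
        omega
      · simp only [Prod.fst_sub, Prod.snd_sub] at i1 i2 i3
        have j1 : c' < c + 1 := by
          have : (c' : ℝ) < c + 1 := by linarith
          exact_mod_cast this
        have j2 : c < c' + 1 := by
          have : (c : ℝ) < c' + 1 := by linarith
          exact_mod_cast this
        obtain rfl : c' = c := by omega
        simp only [hβ, rightHeight, if_true] at i3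
        linarith
    · rintro ⟨-, c', hc', ⟨i1, i2, i3⟩ | ⟨i1, i2, i3⟩⟩ <;>
        norm_num [leftHeight, rightHeight] at i3 <;> linarith
  · refine and_congr_right fun h0 => exists_congr fun c => and_congr_right fun hc =>
      or_congr ?_ ?_
    · refine and_congr_right fun h1 => and_congr_right fun h2 => ?_
      cases hβ : β c
      · simp
      · simp only [leftHeight, if_true]
        refine ⟨fun h4 => ?_, fun h => by norm_num at h; linarith⟩
        by_contra h3
        norm_num at h3
        have h2' : z.1 ≠ 2 * (c : ℝ) + 1 := by exact_mod_cast hne (2 * c + 1)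
        have h2'' := lt_of_le_of_ne h2 h2'
        refine hB (mem_movedPart.2 ⟨c, hc, hβ, ?_, ?_, ?_, ?_⟩) <;>
          simp only [Prod.fst_sub, Prod.snd_sub] <;> linarith
    · refine and_congr_right fun h1 => and_congr_right fun h2 => ?_
      cases hβ : β c
      · simp
      · simp only [rightHeight, if_true]
        refine ⟨fun h => by norm_num; linarith, fun h4 => ?_⟩
        norm_num at h4
        by_contra h3
        have h2' : z.1 ≠ 2 * (c : ℝ) + 2 := by exact_mod_cast hne (2 * c + 2)
        exact hA (mem_movedPart.2 ⟨c, hc, hβ, h1, lt_of_le_of_ne h2 h2', not_le.1 h3, h4⟩)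

theorem measurePreserving_bitMap (β : ℕ → Bool) (N : ℕ) :
    MeasurePreserving (bitMap β N) (cond volume (bitComb (fun _ => false) N))
      (cond volume (bitComb β N)) := by
  refine measurePreserving_cond (measurePreserving_swapMap measurableSet_movedPart ?_)
    measurableSet_comb ?_
  · intro z hz hz'
    obtain ⟨-, -, -, -, -, h1, h2⟩ := mem_movedPart.1 hz
    obtain ⟨-, -, -, -, -, h3, h4⟩ := mem_movedPart.1 hz'
    simp only [Prod.snd_sub] at h3
    linarith
  · filter_upwards [ae_fst_notMem (countable_range fun k : ℕ => (k : ℝ))] with z hz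
    exact propext (mem_bitComb_iff_of_notMem_range hz)

/-- The column of a point. -/
noncomputable def column (N : ℕ) (z : ℝ × ℝ) : ℕ := min ⌊z.1 / 2⌋₊ (N - 1)

theorem column_eq {c : ℕ} (hc : c < N) {z : ℝ × ℝ} (h1 : 2 * (c : ℝ) ≤ z.1)
    (h2 : z.1 < 2 * c + 2) : column N z = c := by
  have h0 : (0 : ℝ) ≤ c := c.cast_nonneg
  have : ⌊z.1 / 2⌋₊ = c := (Nat.floor_eq_iff (by linarith)).2 ⟨by linarith, by linarith⟩
  rw [column, this]
  omega

theorem column_lt (hN : 0 < N) (z : ℝ × ℝ) : column N z < N :=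
  (min_le_right _ _).trans_lt (by omega)

theorem mem_bitComb_of_column {z : ℝ × ℝ} (h : β (column N z) = β' (column N z))
    (hz : z ∈ bitComb β N) : z ∈ bitComb β' N := by
  simp only [bitComb, mem_comb] at hz ⊢
  obtain ⟨h0, c, hc, ⟨h1, h2, h3⟩ | ⟨h1, h2, h3⟩⟩ := hz
  · rw [column_eq hc h1 (by linarith)] at h
    exact ⟨h0, c, hc, .inl ⟨h1, h2, h ▸ h3⟩⟩
  · rcases h2.lt_or_eq with h2' | h2'
    · rw [column_eq hc (by linarith) h2'] at h
      exact ⟨h0, c, hc, .inr ⟨h1, h2, h ▸ h3⟩⟩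
    -- On the wall between columns `c` and `c + 1`, `column` picks `c + 1`, whose left bar covers
    -- height 2 for either bit. On the last wall the cap `N - 1` picks `c` itself.
    · rcases (Nat.succ_le_of_lt hc).lt_or_eq with hc' | hc'
      · refine ⟨h0, c + 1, hc', .inl ⟨?_, ?_, ?_⟩⟩
        · push_cast; linarith
        · push_cast; linarith
        · linarith [(rightHeight_mem (β c)).2, (leftHeight_mem (β' (c + 1))).1]
      · have : ⌊z.1 / 2⌋₊ = c + 1 := by
          rw [h2', show (2 * (c : ℝ) + 2) / 2 = ((c + 1 : ℕ) : ℝ) by push_cast; ring,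
            Nat.floor_natCast]
        have : column N z = c := by
          rw [column, this]
          omega
        rw [this] at h
        exact ⟨h0, c, hc, .inr ⟨h1, h2, h ▸ h3⟩⟩

theorem mem_bitComb_congr {z : ℝ × ℝ} (h : β (column N z) = β' (column N z)) :
    z ∈ bitComb β N ↔ z ∈ bitComb β' N :=
  ⟨mem_bitComb_of_column h, mem_bitComb_of_column h.symm⟩

/-- The exchanged squares lie in the same column, so the image of a raw sample depends only on the
bit of the column of `z`. -/
theorem bitMap_congr {z : ℝ × ℝ} (h : β (column N z) = β' (column N z)) :
    bitMap β N z = bitMap β' N z := by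
  have key : ∀ {β β' : ℕ → Bool}, β (column N z) = β' (column N z) →
      (z ∈ movedPart β N → z ∈ movedPart β' N) ∧
        (z - (-1, 2) ∈ movedPart β N → z - (-1, 2) ∈ movedPart β' N) := by
    intro β β' h
    constructor
    · intro hz
      obtain ⟨c, hc, hβ, h1, h2, h3⟩ := mem_movedPart.1 hz
      rw [column_eq hc (by linarith) h2] at h
      exact mem_movedPart.2 ⟨c, hc, h ▸ hβ, h1, h2, h3⟩
    · intro hz
      obtain ⟨c, hc, hβ, h1, h2, h3⟩ := mem_movedPart.1 hz
      have h1' := h1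
      have h2' := h2
      simp only [Prod.fst_sub] at h1' h2'
      rw [column_eq hc (by linarith) (by linarith)] at h
      exact mem_movedPart.2 ⟨c, hc, h ▸ hβ, h1, h2, h3⟩
  have e1 : z ∈ movedPart β N ↔ z ∈ movedPart β' N := ⟨(key h).1, (key h.symm).1⟩
  have e2 : z - (-1, 2) ∈ movedPart β N ↔ z - (-1, 2) ∈ movedPart β' N :=
    ⟨(key h).2, (key h.symm).2⟩
  unfold bitMap swapMap
  by_cases hA : z ∈ movedPart β N
  · rw [if_pos hA, if_pos (e1.1 hA)]
  · rw [if_neg hA, if_neg (fun h => hA (e1.2 h))]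
    by_cases hB : z - (-1, 2) ∈ movedPart β N
    · rw [if_pos hB, if_pos (e2.1 hB)]
    · rw [if_neg hB, if_neg (fun h => hB (e2.2 h))]

/-- If one of the combs has bits `false` only, then the union of the combs has the bars `4, 2` in
each column with some bit `true`, and the bars `3, 2` in the other columns. -/
theorem iUnion_bitComb {ι : Type*} (B : ι → ℕ → Bool) {i₀ : ι} (h₀ : ∀ c, B i₀ c = false)
    (s : ℕ → Bool) (hs : ∀ c, s c = true ↔ ∃ i, B i c = true) :
    ⋃ i, bitComb (B i) N = comb (fun c => leftHeight (s c)) (fun _ => 2) N := by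
  ext z
  simp only [mem_iUnion, bitComb, mem_comb]
  constructor
  · rintro ⟨i, h0, c, hc, ⟨h1, h2, h3⟩ | ⟨h1, h2, h3⟩⟩
    · refine ⟨h0, c, hc, .inl ⟨h1, h2, ?_⟩⟩
      cases hb : B i c
      · rw [hb] at h3
        exact h3.trans (le_trans (by norm_num [leftHeight]) (leftHeight_mem (s c)).1)
      · rw [(hs c).2 ⟨i, hb⟩]
        rwa [hb] at h3
    · exact ⟨h0, c, hc, .inr ⟨h1, h2, h3.trans (rightHeight_mem _).2⟩⟩
  · rintro ⟨h0, c, hc, ⟨h1, h2, h3⟩ | ⟨h1, h2, h3⟩⟩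
    · cases hb : s c
      · rw [hb] at h3
        exact ⟨i₀, h0, c, hc, .inl ⟨h1, h2, by rwa [h₀]⟩⟩
      · obtain ⟨i, hi⟩ := (hs c).1 hb
        rw [hb] at h3
        exact ⟨i, h0, c, hc, .inl ⟨h1, h2, by rwa [hi]⟩⟩
    · exact ⟨i₀, h0, c, hc, .inr ⟨h1, h2, by rw [h₀]; simpa [rightHeight] using h3⟩⟩

end BitComb

/-! ### Concentration of the union area -/

/-- Additivity of the variance of independent centred variables: on splitting off the first one, the
cross term vanishes by `hY`. -/
theorem second_moment {S : Type*} [Fintype S] [DecidableEq S] {ν Y : S → ℝ} (hν : ∑ x, ν x = 1)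
    (hY : ∑ x, ν x * Y x = 0) (N : ℕ) :
    ∑ s : Fin N → S, (∏ c, ν (s c)) * (∑ c, Y (s c)) ^ 2 = N * ∑ x, ν x * Y x ^ 2 := by
  induction N with
  | zero => simp
  | succ N ih =>
    have hW : ∑ s : Fin N → S, ∏ c, ν (s c) = 1 := by
      rw [sum_bitVec_prod fun _ => ν]
      simp [hν]
    rw [← (Fin.consEquiv fun _ => S).sum_comp, Fintype.sum_prod_type]
    have : ∀ (x : S) (s : Fin N → S),
        (∏ c, ν ((Fin.consEquiv fun _ => S) (x, s) c)) *
          (∑ c, Y ((Fin.consEquiv fun _ => S) (x, s) c)) ^ 2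
        = (ν x * Y x ^ 2) * (∏ c, ν (s c))
          + (ν x * Y x) * (2 * ((∏ c, ν (s c)) * ∑ c, Y (s c)))
          + ν x * ((∏ c, ν (s c)) * (∑ c, Y (s c)) ^ 2) := by
      intro x s
      simp only [Fin.consEquiv_apply, Fin.prod_univ_succ, Fin.sum_univ_succ, Fin.cons_zero,
        Fin.cons_succ]
      ring
    simp only [this, Finset.sum_add_distrib, ← Finset.mul_sum, ← Finset.sum_mul, hW, hY, hν, ih]
    push_cast
    ring

/-- The indicator that some bit other than bit `0` is `true`. -/
noncomputable def someBit {m : ℕ} (x : Fin (m + 1) → Bool) : ℝ :=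
  if ∃ i, i ≠ 0 ∧ x i = true then 1 else 0

theorem sum_someBit (m : ℕ) (a : ℝ) :
    ∑ x : Fin (m + 1) → Bool, bitWeight (fun _ => a) x * someBit x = 1 - (1 - a) ^ m := by
  have h1 : ∀ x : Fin (m + 1) → Bool, bitWeight (fun _ => a) x * someBit x
      = bitWeight (fun _ => a) x
        -- The complementary event, all bits other than bit `0` off, written as a product so that
        -- its sum factorizes.
        - ∏ i, (if x i then (if i = 0 then a else 0) else 1 - a) := by
    intro x
    by_cases hx : ∃ i, i ≠ 0 ∧ x i = true
    · obtain ⟨i, hi, hxi⟩ := hx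
      rw [Finset.prod_eq_zero (Finset.mem_univ i) (by simp [hi, hxi]), someBit,
        if_pos ⟨i, hi, hxi⟩]
      ring
    · rw [someBit, if_neg hx, mul_zero, eq_comm, sub_eq_zero]
      refine Finset.prod_congr rfl fun i _ => ?_
      by_cases hi : i = 0
      · simp [hi]
      · have : x i = false := by
          by_contra h
          exact hx ⟨i, hi, by simpa using h⟩
        simp [this]
  simp only [h1]
  rw [Finset.sum_sub_distrib, sum_bitWeight,
    sum_bitVec_prod fun i (v : Bool) => if v then (if i = (0 : Fin (m + 1)) then a else 0) else 1 - a]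
  congr 1
  rw [Fin.prod_univ_succ]
  simp [Fin.succ_ne_zero]

/-- The number of columns in which some bit other than bit `0` is `true`. -/
noncomputable def tallColumns {m N : ℕ} (b : Fin N × Fin (m + 1) → Bool) : ℝ :=
  ∑ c, someBit fun i => b (c, i)

/-- Chebyshev's inequality: columns are independent and each has variance at most 1. -/
theorem one_sub_le_bitMean_tallColumns {m N : ℕ} (hN : 0 < N) {a τ : ℝ} (ha : a ∈ Icc (0 : ℝ) 1)
    (hτ : 0 < τ) : 1 - 1 / (τ ^ 2 * N) ≤ bitMean (fun _ => a)
      ({b : Fin N × Fin (m + 1) → Bool |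
        |tallColumns b - N * (1 - (1 - a) ^ m)| ≤ τ * N}.indicator 1) := by
  set g := 1 - (1 - a) ^ m with hg
  have hN' : (0 : ℝ) < N := by exact_mod_cast hN
  have hg01 : 0 ≤ g ∧ g ≤ 1 := by
    have h1 : 0 ≤ (1 - a) ^ m := pow_nonneg (by linarith [ha.2]) m
    have h2 : (1 - a) ^ m ≤ 1 := pow_le_one₀ (by linarith [ha.2]) (by linarith [ha.1])
    constructor <;> linarith
  have hν0 : ∀ x : Fin (m + 1) → Bool, 0 ≤ bitWeight (fun _ => a) x :=
    bitWeight_nonneg fun _ => ha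
  have hν : ∑ x : Fin (m + 1) → Bool, bitWeight (fun _ => a) x = 1 := sum_bitWeight _
  have hmean : ∑ x : Fin (m + 1) → Bool, bitWeight (fun _ => a) x * (someBit x - g) = 0 := by
    simp only [mul_sub, Finset.sum_sub_distrib, sum_someBit, ← Finset.sum_mul, hν]
    rw [hg]
    ring
  have hvar : ∑ x : Fin (m + 1) → Bool, bitWeight (fun _ => a) x * (someBit x - g) ^ 2 ≤ 1 := by
    rw [← hν]
    refine Finset.sum_le_sum fun x _ => mul_le_of_le_one_right (hν0 x) ?_
    unfold someBit
    split_ifs <;> nlinarith [hg01.1, hg01.2]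
  have hT : bitMean (fun _ : Fin N × Fin (m + 1) => a)
      (fun b => (tallColumns b - N * g) ^ 2) ≤ N := by
    have h2 := second_moment hν hmean N
    have h3 : bitMean (fun _ : Fin N × Fin (m + 1) => a) (fun b => (tallColumns b - N * g) ^ 2)
        = ∑ s : Fin N → Fin (m + 1) → Bool, (∏ c, bitWeight (fun _ => a) (s c)) *
          (∑ c, (someBit (s c) - g)) ^ 2 := by
      unfold bitMean
      rw [← (Equiv.curry (Fin N) (Fin (m + 1)) Bool).sum_comp]
      refine Finset.sum_congr rfl fun b _ => ?_
      congr 1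
      · unfold bitWeight
        rw [Fintype.prod_prod_type]
        rfl
      · rw [Finset.sum_sub_distrib]
        simp only [tallColumns, Finset.sum_const, Finset.card_univ, Fintype.card_fin, nsmul_eq_mul]
        rfl
    rw [h3, h2]
    nlinarith
  have hpt : bitMean (fun _ : Fin N × Fin (m + 1) => a)
      (fun b => 1 - (tallColumns b - N * g) ^ 2 / (τ * N) ^ 2) ≤ bitMean (fun _ => a)
      ({b : Fin N × Fin (m + 1) → Bool |
        |tallColumns b - N * g| ≤ τ * N}.indicator 1) := by
    refine bitMean_mono (fun _ => ha) fun b => ?_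
    by_cases hb : |tallColumns b - N * g| ≤ τ * N
    · rw [indicator_of_mem (show b ∈ {b : Fin N × Fin (m + 1) → Bool |
        |tallColumns b - N * g| ≤ τ * N} from hb), Pi.one_apply]
      linarith [show 0 ≤ (tallColumns b - N * g) ^ 2 / (τ * N) ^ 2 by positivity]
    · rw [indicator_of_notMem (show b ∉ {b : Fin N × Fin (m + 1) → Bool |
        |tallColumns b - N * g| ≤ τ * N} from hb), sub_nonpos, one_le_div (by positivity),
        ← sq_abs (tallColumns b - N * g)]
      exact pow_le_pow_left₀ (by positivity) (not_le.1 hb).le 2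
  refine le_trans ?_ hpt
  have hlin : bitMean (fun _ : Fin N × Fin (m + 1) => a)
      (fun b => 1 - (tallColumns b - N * g) ^ 2 / (τ * N) ^ 2)
      = 1 - bitMean (fun _ : Fin N × Fin (m + 1) => a)
        (fun b => (tallColumns b - N * g) ^ 2) / (τ * N) ^ 2 := by
    unfold bitMean
    simp only [mul_sub, mul_one, Finset.sum_sub_distrib, sum_bitWeight, Finset.sum_div,
      mul_div_assoc]
  rw [hlin]
  refine sub_le_sub_left ?_ 1
  calc bitMean (fun _ : Fin N × Fin (m + 1) => a)
        (fun b => (tallColumns b - N * g) ^ 2) / (τ * N) ^ 2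
      ≤ N / (τ * N) ^ 2 := by gcongr
    _ = 1 / (τ ^ 2 * N) := by field_simp

/-- Weighted Cauchy–Schwarz with the factor `a ^ 2 / a' + (1 - a) ^ 2 / (1 - a') = 1 + (a - a') ^ 2
/ (a' * (1 - a'))`, which is one plus the chi-square divergence. The square given to `nlinarith` is
exactly the defect, after denominators are cleared. -/
theorem bitComparable_of_sq_le {K a a' : ℝ} (ha : a ∈ Icc (0 : ℝ) 1) (ha' : a' ∈ Ioo (0 : ℝ) 1)
    (hK : (a - a') ^ 2 ≤ (K - 1) * (a' * (1 - a'))) : BitComparable K a a' := by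
  refine ⟨ha, Ioo_subset_Icc_self ha', fun x y => ?_⟩
  obtain ⟨h0, h1⟩ := ha'
  have hd : 0 < a' * (1 - a') := mul_pos h0 (by linarith)
  have hQ : 0 ≤ a' * x ^ 2 + (1 - a') * y ^ 2 :=
    add_nonneg (mul_nonneg h0.le (sq_nonneg x)) (mul_nonneg (by linarith) (sq_nonneg y))
  have h2 : (a' * (1 - a') + (a - a') ^ 2) * (a' * x ^ 2 + (1 - a') * y ^ 2)
      ≤ (K * (a' * (1 - a'))) * (a' * x ^ 2 + (1 - a') * y ^ 2) :=
    mul_le_mul_of_nonneg_right (by linarith) hQ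
  refine le_of_mul_le_mul_left ?_ hd
  nlinarith [sq_nonneg (a * (1 - a') * y - (1 - a) * a' * x)]

/-! ### Small errors: combs -/

/-- The bits of object `i`, column by column; those of object `0` are set to `false`. -/
def combBits {m N : ℕ} (b : Fin N × Fin (m + 1) → Bool) (i : Fin (m + 1)) (c : ℕ) : Bool :=
  decide (i ≠ 0) && if h : c < N then b (⟨c, h⟩, i) else false

theorem volume_iUnion_bitComb {m N : ℕ} (b : Fin N × Fin (m + 1) → Bool) :
    (volume (⋃ i, bitComb (combBits b i) N)).toReal = 5 * N + tallColumns b := by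
  rw [iUnion_bitComb (combBits b) (i₀ := 0) (fun c => by simp [combBits])
    (fun c => decide (∃ i, combBits b i c = true)) (fun c => by simp),
    volume_comb (fun c => by linarith [(leftHeight_mem (decide (∃ i, combBits b i c = true))).1])
    (fun _ => zero_le_two), ENNReal.toReal_ofReal
    (Finset.sum_nonneg fun c _ => by
      linarith [(leftHeight_mem (decide (∃ i, combBits b i c = true))).1]), Finset.sum_range]
  have : ∀ c : Fin N, leftHeight (decide (∃ i, combBits b i c = true)) + 2
      = 5 + someBit fun i => b (c, i) := by
    intro c
    simp only [leftHeight, someBit, combBits, decide_eq_true_eq, Bool.and_eq_true, c.isLt,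
      dif_pos]
    split_ifs <;> norm_num
  simp only [this, Finset.sum_add_distrib, tallColumns]
  simp [mul_comm]

theorem combBits_congr {m N : ℕ} {b b' : Fin N × Fin (m + 1) → Bool} {c : ℕ} (hc : c < N)
    {i : Fin (m + 1)} (h : b (⟨c, hc⟩, i) = b' (⟨c, hc⟩, i)) :
    combBits b i c = combBits b' i c := by
  simp only [combBits, hc, dif_pos, h]

/-- From `(1 - a') * (1 + (a' - a)) ≤ 1 - a`, Bernoulli's inequality gives the gap `(1 - a') ^ m * m
* (a' - a)`, and a second use of it gives `(1 - a') ^ m ≥ 1 / 2`. -/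
theorem pow_gap {a a' : ℝ} (m : ℕ) (h : a ≤ a') (h' : a' < 1) (ha : 0 ≤ a')
    (hm : m * a' ≤ 1 / 2) : 1 / 2 * (m * (a' - a)) ≤ (1 - a) ^ m - (1 - a') ^ m := by
  have h1 : (1 - a') * (1 + (a' - a)) ≤ 1 - a := by nlinarith
  have h2 : ((1 - a') * (1 + (a' - a))) ^ m ≤ (1 - a) ^ m :=
    pow_le_pow_left₀ (mul_nonneg (by linarith) (by linarith)) h1 m
  have h3 : 1 + m * (a' - a) ≤ (1 + (a' - a)) ^ m := one_add_mul_le_pow (by linarith) m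
  have h4 : 1 + m * (-a') ≤ (1 + -a') ^ m := one_add_mul_le_pow (by linarith) m
  rw [← sub_eq_add_neg] at h4
  have h5 : 1 / 2 ≤ (1 - a') ^ m := by linarith
  rw [mul_pow] at h2
  have h6 : 0 ≤ m * (a' - a) := mul_nonneg m.cast_nonneg (by linarith)
  nlinarith [mul_le_mul_of_nonneg_left h3 (show 0 ≤ (1 - a') ^ m by linarith)]

theorem le_queries_of_small_error {Ω : Type*} [MeasurableSpace Ω] {P : Measure Ω}
    [IsProbabilityMeasure P] {n q : ℕ} {ε : ℝ} (hn : 2 ≤ n) (hε : 0 < ε) (hε' : ε ≤ 1 / 128)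
    {A : QueryAlgorithm Ω n} (hA : A.Solves P ε q (equiponderousPolygonInstances n)) :
    1 / 98304 * (n / ε ^ 2) ≤ q := by
  obtain ⟨m, rfl⟩ : ∃ m, n = m + 1 := ⟨n - 1, by omega⟩
  have hm1 : (1 : ℝ) ≤ m := by
    have : 1 ≤ m := by omega
    exact_mod_cast this
  have hm0 : (0 : ℝ) < m := by linarith
  -- Enough columns for Chebyshev with `τ = ε` to fail with probability at most `1 / 100`; `N` does
  -- not enter the query bound.
  obtain ⟨N, hN⟩ := exists_nat_ge (100 / ε ^ 2)
  have hN0' : (0 : ℝ) < N := lt_of_lt_of_le (by positivity) hN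
  have hN0 : 0 < N := by exact_mod_cast hN0'
  have hηN : 1 / (ε ^ 2 * N) ≤ 1 / 100 := by
    rw [div_le_iff₀ (by positivity)] at hN
    refine one_div_le_one_div_of_le (by norm_num) (by linarith)
  -- Per column, `1 / 4` against `1 / 4 + 32 * ε ≤ 1 / 2` bits are expected to be on. By `pow_gap`
  -- the shares of tall columns differ by `16 * ε`, more than the `14 * ε` lost to the tolerance and
  -- the fluctuations.
  set a : ℝ := 1 / 4 / m with ha_def
  set a' : ℝ := (1 / 4 + 32 * ε) / m with ha'_def
  have ham : m * a = 1 / 4 := by rw [ha_def]; field_simp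
  have ham' : m * a' = 1 / 4 + 32 * ε := by rw [ha'_def]; field_simp
  have ha0 : 0 < a := by positivity
  have ha'0 : 0 < a' := by positivity
  have haa' : a ≤ a' := by
    rw [ha_def, ha'_def]
    gcongr
    linarith
  have ha'1 : a' ≤ 1 / 2 := by nlinarith
  have ha : a ∈ Icc (0 : ℝ) 1 := ⟨ha0.le, by linarith⟩
  have ha' : a' ∈ Icc (0 : ℝ) 1 := ⟨ha'0.le, by linarith⟩
  set K : ℝ := 1 + 8192 * ε ^ 2 / m with hK_def
  have hK1 : 1 ≤ K := by
    rw [hK_def]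
    linarith [show 0 ≤ 8192 * ε ^ 2 / m by positivity]
  have hcomp : BitComparable K a a' := by
    refine bitComparable_of_sq_le ha ⟨ha'0, by linarith⟩ ?_
    have e1 : (a - a') ^ 2 = 8192 * ε ^ 2 / m * (1 / 8 / m) := by
      rw [ha_def, ha'_def]
      field_simp
      ring
    have e2 : 1 / 8 / m ≤ a' * (1 - a') := by
      rw [div_le_iff₀ hm0]
      nlinarith
    rw [e1, hK_def, add_sub_cancel_left]
    exact mul_le_mul_of_nonneg_left e2 (by positivity)
  set g := 1 - (1 - a) ^ m with hg
  set g' := 1 - (1 - a') ^ m with hg'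
  have hgap : g + 16 * ε ≤ g' := by
    have := pow_gap m haa' (by linarith) ha'0.le (by linarith)
    rw [show m * (a' - a) = 32 * ε by rw [mul_sub, ham, ham']; ring] at this
    rw [hg, hg']
    linarith
  have hg0 : 0 ≤ g := by
    have : (1 - a) ^ m ≤ 1 := pow_le_one₀ (by linarith [ha.2]) (by linarith)
    linarith
  have hg'1 : g' ≤ 1 := by
    have : 0 ≤ (1 - a') ^ m := pow_nonneg (by linarith) m
    linarith
  have key := sq_le_of_solves hA (ι := Fin N × Fin (m + 1))
    (O := fun b i => bitComb (combBits b i) N) (Z := ℝ × ℝ)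
    (fun b => ⟨fun i => isAxisAlignedPolygon_bitComb hN0, fun i j => by
      simp only [volume_bitComb]⟩)
    (fun b i => measurableSet_comb)
    (m := fun _ => cond volume (bitComb (fun _ => false) N))
    (hprob := fun _ => by
      refine cond_isProbabilityMeasure_of_finite ?_ ?_
      · rw [volume_bitComb]
        simpa using hN0.ne'
      · rw [volume_bitComb]
        exact ENNReal.ofReal_ne_top)
    (φ := fun b i => bitMap (combBits b i) N)
    (fun b i => measurePreserving_bitMap _ N)
    (fun z a => by
      rcases a with i | i | ⟨i, p⟩
      -- The answer is constant, so any bit will do.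
      · refine ⟨(⟨0, hN0⟩, 0), fun b b' _ => ?_⟩
        simp only [answer, volume_bitComb]
      · refine ⟨(⟨column N (z i), column_lt hN0 _⟩, i), fun b b' h => ?_⟩
        simp only [answer]
        rw [bitMap_congr (combBits_congr _ h)]
      · refine ⟨(⟨column N p, column_lt hN0 _⟩, i), fun b b' h => ?_⟩
        simp only [answer]
        rw [mem_bitComb_congr (combBits_congr _ h)])
    hK1 (p := fun _ => a) (p' := fun _ => a') (fun _ => hcomp)
    (E := Iic ((1 + ε) * (N * (5 + g + ε)))) measurableSet_Iic
    (G := {b | |tallColumns b - N * g| ≤ ε * N}) (G' := {b | |tallColumns b - N * g'| ≤ ε * N})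
    (fun b hb ρ hρ => by
      rw [volume_iUnion_bitComb] at hρ
      have h1 := (abs_le.1 hρ).2
      have h2 := (abs_le.1 (show |tallColumns b - N * g| ≤ ε * N from hb)).2
      rw [mem_Iic]
      nlinarith)
    (fun b hb ρ hρ => by
      rw [volume_iUnion_bitComb] at hρ
      have h1 := (abs_le.1 hρ).1
      have h2 := (abs_le.1 (show |tallColumns b - N * g'| ≤ ε * N from hb)).1
      rw [mem_Iic, not_le]
      have h3 : (1 + ε) * (5 + g + ε) < (1 - ε) * (5 + g' - ε) := by nlinarith
      have h4 := mul_lt_mul_of_pos_left h3 hN0'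
      nlinarith)
    (η := 1 / 100) (by norm_num)
    ((one_sub_le_bitMean_tallColumns hN0 ha hε).trans' (by linarith))
    ((one_sub_le_bitMean_tallColumns hN0 ha' hε).trans' (by linarith))
  -- With `η = 1 / 100`, `key` reads `0.66 ^ 2 ≤ K ^ q * (1 / 3 + 1 / 100)`.
  have hpow : 6 / 5 ≤ K ^ q := by
    by_contra hcon
    norm_num at key
    nlinarith
  have hexp : K ^ q ≤ Real.exp (8192 * ε ^ 2 / m * q) := by
    rw [mul_comm, Real.exp_nat_mul]
    refine pow_le_pow_left₀ (by linarith) ?_ q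
    rw [hK_def, add_comm]
    exact Real.add_one_le_exp _
  have hlog : 1 / 6 ≤ 8192 * ε ^ 2 / m * q := by
    have h2 : Real.log (6 / 5) ≤ 8192 * ε ^ 2 / m * q :=
      (Real.log_le_iff_le_exp (by norm_num)).2 (hpow.trans hexp)
    have h3 := Real.one_sub_inv_le_log_of_pos (by norm_num : (0 : ℝ) < 6 / 5)
    norm_num at h3 ⊢
    linarith
  rw [div_mul_eq_mul_div, le_div_iff₀ hm0] at hlog
  rw [← mul_div_assoc, div_le_iff₀ (by positivity)]
  push_cast
  linarith

/-! ### Large errors: rectangles -/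

/-- The rectangle `[v, v + 1] × [0, h]`, as a histogram with one bar. -/
noncomputable def bar (v h : ℝ) : Set (ℝ × ℝ) :=
  histogram (fun k => v + k) (fun k => if k = 1 then h else 0) 1

theorem strictMono_add_natCast (v : ℝ) : StrictMono fun k : ℕ => v + (k : ℝ) := fun k l hkl => by
  have : (k : ℝ) < l := by exact_mod_cast hkl
  dsimp only
  linarith

theorem isAxisAlignedPolygon_bar (v : ℝ) {h : ℝ} (hh : 0 < h) : IsAxisAlignedPolygon (bar v h) := by
  refine IsProfile.isAxisAlignedPolygon ⟨one_pos, strictMono_add_natCast v, by simp, by simp, ?_, ?_⟩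
  · intro k hk
    obtain rfl : k = 0 := by omega
    simpa using hh
  · intro k hk
    omega

theorem mem_bar {v h : ℝ} {z : ℝ × ℝ} :
    z ∈ bar v h ↔ 0 ≤ z.2 ∧ v ≤ z.1 ∧ z.1 ≤ v + 1 ∧ z.2 ≤ h := by
  refine and_congr_right fun _ => ⟨?_, ?_⟩
  · rintro ⟨k, hk, h'⟩
    obtain rfl : k = 0 := by omega
    simpa using h'
  · intro h'
    exact ⟨0, one_pos, by simpa using h'⟩

theorem volume_bar (v h : ℝ) : volume (bar v h) = ENNReal.ofReal h := by
  rw [bar, volume_histogram (strictMono_add_natCast v)]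
  simp

theorem isProbabilityMeasure_cond_bar (v : ℝ) {h : ℝ} (hh : 0 < h) :
    IsProbabilityMeasure (cond volume (bar v h)) := by
  refine cond_isProbabilityMeasure_of_finite ?_ ?_
  · rw [volume_bar]
    simpa using hh
  · rw [volume_bar]
    exact ENNReal.ofReal_ne_top

/-- Unit squares, of which those in the blocks `j` with `b j = true` are replaced by other
rectangles. -/
noncomputable def blockInstance {n k : ℕ} (blk : Fin n → Fin k) (v : Fin n → ℝ) (h : ℝ)
    (b : Fin k → Bool) (i : Fin n) : Set (ℝ × ℝ) :=
  if b (blk i) then bar (v i) h else bar 0 1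

section Blocks

variable {n k : ℕ} {blk : Fin n → Fin k} {v : Fin n → ℝ} {h : ℝ}

theorem isAxisAlignedPolygon_blockInstance (hh : 0 < h) (b : Fin k → Bool) (i : Fin n) :
    IsAxisAlignedPolygon (blockInstance blk v h b i) := by
  unfold blockInstance
  split_ifs
  · exact isAxisAlignedPolygon_bar _ hh
  · exact isAxisAlignedPolygon_bar _ one_pos

theorem volume_iUnion_blockInstance_ne_top (hh : 0 < h) (b : Fin k → Bool) :
    volume (⋃ i, blockInstance blk v h b i) ≠ ∞ :=
  (isCompact_iUnion fun i => (isAxisAlignedPolygon_blockInstance hh b i).1).measure_ne_top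

/-- The instance with all bits off is tested against independent bits that are on with probability
`a'`. As `p = 0`, comparability only needs `K * (1 - a') = 1`. The choice `1 - a' = exp (-(7 / k))`
leaves all bits off with probability `exp (-7) ≤ 1 / 100`, and makes `K ^ q = exp (7 * q / k)`. -/
theorem le_queries_of_blocks {Ω : Type*} [MeasurableSpace Ω] {P : Measure Ω}
    [IsProbabilityMeasure P] {q : ℕ} {ε : ℝ} {A : QueryAlgorithm Ω n}
    {I : Set (Fin n → Set (ℝ × ℝ))} (hA : A.Solves P ε q I) (hn : 0 < n) (hk : 0 < k) (hh : 0 < h)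
    (hI : ∀ b, blockInstance blk v h b ∈ I)
    (hV : ∀ b : Fin k → Bool, ∀ j, b j = true →
      1 + ε < (1 - ε) * (volume (⋃ i, blockInstance blk v h b i)).toReal) :
    1 / 42 * (k : ℝ) ≤ q := by
  have hk' : (0 : ℝ) < k := by exact_mod_cast hk
  set a' : ℝ := 1 - Real.exp (-(7 / k)) with ha'_def
  set K : ℝ := Real.exp (7 / k) with hK_def
  have hexp1 : Real.exp (-(7 / k)) ≤ 1 := Real.exp_le_one_iff.2 (by
    rw [neg_nonpos]
    positivity)
  have ha' : a' ∈ Icc (0 : ℝ) 1 := ⟨by linarith, by linarith [Real.exp_pos (-(7 / (k : ℝ)))]⟩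
  have hK1 : 1 ≤ K := Real.one_le_exp (by positivity)
  have hKa : K * (1 - a') = 1 := by
    rw [ha'_def, hK_def, sub_sub_cancel, ← Real.exp_add, add_neg_cancel, Real.exp_zero]
  have hcomp : BitComparable K 0 a' := by
    refine ⟨by simp, ha', fun x y => ?_⟩
    have : 0 ≤ K * (a' * x ^ 2) := mul_nonneg (by linarith) (mul_nonneg ha'.1 (sq_nonneg x))
    rw [mul_add, ← mul_assoc K (1 - a'), hKa]
    linarith
  have hne : Nonempty (Fin n) := ⟨⟨0, hn⟩⟩
  have hprob0 := isProbabilityMeasure_cond_bar 0 one_pos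
  have hprob1 : ∀ i, IsProbabilityMeasure (cond volume (bar (v i) h)) := fun i =>
    isProbabilityMeasure_cond_bar _ hh
  have hV0 : (volume (⋃ i, blockInstance blk v h (fun _ => false) i)).toReal = 1 := by
    simp [blockInstance, iUnion_const, volume_bar]
  have hmean0 : bitMean (fun _ : Fin k => (0 : ℝ)) (({fun _ => false} : Set _).indicator 1) = 1 := by
    unfold bitMean
    rw [Finset.sum_eq_single (fun _ => false)]
    · simp [bitWeight]
    · intro b _ hb
      rw [indicator_of_notMem (by simpa using hb), mul_zero]
    · simp
  have hmean1 : 1 - 1 / 100 ≤ bitMean (fun _ : Fin k => a')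
      (({fun _ => false} : Set _)ᶜ.indicator 1) := by
    have h1 : ∀ b : Fin k → Bool, bitWeight (fun _ => a') b *
        (({fun _ => false} : Set (Fin k → Bool))ᶜ.indicator 1 b)
        = bitWeight (fun _ => a') b
          - if b = (fun _ => false) then bitWeight (fun _ => a') b else 0 := by
      intro b
      by_cases hb : b = fun _ => false
      · simp [hb]
      · simp [hb]
    have h2 : bitWeight (fun _ : Fin k => a') (fun _ => false) = Real.exp (-7) := by
      simp only [bitWeight, Bool.false_eq_true, if_false, Finset.prod_const, Finset.card_univ,
        Fintype.card_fin, ha'_def, sub_sub_cancel]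
      rw [← Real.exp_nat_mul]
      congr 1
      field_simp
    have h3 : Real.exp (-7) ≤ 1 / 100 := by
      rw [Real.exp_neg, ← one_div]
      refine one_div_le_one_div_of_le (by norm_num) ?_
      have h4 : (2 : ℝ) ≤ Real.exp 1 := by
        have := Real.add_one_le_exp (1 : ℝ)
        linarith
      calc (100 : ℝ) ≤ 2 ^ 7 := by norm_num
        _ ≤ Real.exp 1 ^ 7 := pow_le_pow_left₀ (by norm_num) h4 7
        _ = Real.exp 7 := by rw [← Real.exp_nat_mul]; norm_num
    unfold bitMean
    simp only [h1, Finset.sum_sub_distrib, sum_bitWeight, Finset.sum_ite_eq', Finset.mem_univ,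
      if_true, h2]
    linarith
  have key := sq_le_of_solves hA (ι := Fin k) (O := blockInstance blk v h)
    (Z := (ℝ × ℝ) × (ℝ × ℝ)) hI
    (fun b i => (isAxisAlignedPolygon_blockInstance hh b i).1.isClosed.measurableSet)
    (m := fun i => (cond volume (bar 0 1)).prod (cond volume (bar (v i) h)))
    -- A raw sample holds one point of each possible shape of object `i`; the bit selects which one
    -- is shown.
    (φ := fun b i => if b (blk i) then Prod.snd else Prod.fst)
    (fun b i => by
      unfold blockInstance
      cases b (blk i)
      · exact measurePreserving_fst
      · exact measurePreserving_snd)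
    (fun z a => by
      rcases a with i | i | ⟨i, p⟩ <;> refine ⟨blk i, fun b b' e => ?_⟩ <;>
        simp only [answer, blockInstance, e])
    hK1 (p := fun _ => 0) (p' := fun _ => a') (fun _ => hcomp)
    (E := Iic (1 + ε)) measurableSet_Iic (G := {fun _ => false}) (G' := {fun _ => false}ᶜ)
    (fun b hb ρ hρ => by
      obtain rfl : b = fun _ => false := hb
      rw [hV0] at hρ
      have := (abs_le.1 hρ).2
      rw [mem_Iic]
      linarith)
    (fun b hb ρ hρ => by
      have hb' : ∃ j, b j = true := by
        by_contra hcon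
        exact hb (funext fun j => by
          cases hj : b j
          · rfl
          · exact (hcon ⟨j, hj⟩).elim)
      obtain ⟨j, hj⟩ := hb'
      have h1 := hV b j hj
      have h2 := (abs_le.1 hρ).1
      rw [mem_Iic, not_le]
      linarith)
    (η := 1 / 100) (by norm_num) (by rw [hmean0]; norm_num) hmean1
  have hpow : 6 / 5 ≤ K ^ q := by
    by_contra hcon
    norm_num at key
    nlinarith
  have hlog : 1 / 6 ≤ 7 / k * (q : ℝ) := by
    rw [hK_def, ← Real.exp_nat_mul, mul_comm] at hpow
    have h2 := (Real.log_le_iff_le_exp (by norm_num)).2 hpow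
    have h3 := Real.one_sub_inv_le_log_of_pos (by norm_num : (0 : ℝ) < 6 / 5)
    norm_num at h3 ⊢
    linarith
  rw [div_mul_eq_mul_div, le_div_iff₀ hk'] at hlog
  linarith

theorem le_volume_of_bar_subset (hh : 0 < h) {b : Fin k → Bool} {i : Fin n}
    (hi : b (blk i) = true) :
    h ≤ (volume (⋃ i, blockInstance blk v h b i)).toReal := by
  rw [← ENNReal.ofReal_le_iff_le_toReal (volume_iUnion_blockInstance_ne_top hh b),
    ← volume_bar (v i) h]
  refine measure_mono (subset_iUnion_of_subset i ?_)
  simp [blockInstance, hi]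

end Blocks

theorem le_queries_of_polygons {Ω : Type*} [MeasurableSpace Ω] {P : Measure Ω}
    [IsProbabilityMeasure P] {n q : ℕ} {ε : ℝ} (hn : 2 ≤ n) (hε : 0 < ε) (hε' : ε < 1)
    {A : QueryAlgorithm Ω n} (hA : A.Solves P ε q (polygonInstances n)) :
    1 / 42 * (n : ℝ) ≤ q := by
  have h1 : 0 < 1 - ε := by linarith
  set R : ℝ := (1 + ε) / (1 - ε) + 1 with hR
  have hRpos : 0 < R := by positivity
  have hεR : 1 + ε < (1 - ε) * R := by
    rw [hR, mul_add, mul_div_cancel₀ _ h1.ne']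
    linarith
  refine le_queries_of_blocks hA (blk := id) (v := fun _ => 0) (h := R) (by omega) (by omega) hRpos
    (fun b i => isAxisAlignedPolygon_blockInstance hRpos b i) fun b j hj => ?_
  exact hεR.trans_le (mul_le_mul_of_nonneg_left (le_volume_of_bar_subset hRpos hj) h1.le)

theorem le_queries_of_equiponderous {Ω : Type*} [MeasurableSpace Ω] {P : Measure Ω}
    [IsProbabilityMeasure P] {n q R : ℕ} {ε : ℝ} (hn : 2 ≤ n) (hε : 0 < ε) (hε' : ε < 1)
    (hεR : 1 + ε < (1 - ε) * R) {A : QueryAlgorithm Ω n}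
    (hA : A.Solves P ε q (equiponderousPolygonInstances n)) : 1 / (84 * (R : ℝ)) * n ≤ q := by
  have h1 : 0 < 1 - ε := by linarith
  have hRpos : (0 : ℝ) < R := by
    by_contra hcon
    nlinarith
  have hR0 : 0 < R := by exact_mod_cast hRpos
  rw [one_div_mul_eq_div, div_le_iff₀ (by positivity)]
  -- With fewer than `R` objects a constant bound suffices: a single block, in which all objects
  -- become rectangles of area `R` together, keeps the areas equal.
  rcases lt_or_ge n R with hnR | hnR
  · have hq := le_queries_of_blocks hA (k := 1) (blk := fun _ => 0) (v := fun _ => 0) (h := R)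
      (by omega) one_pos hRpos
      (fun b => ⟨fun i => isAxisAlignedPolygon_blockInstance hRpos b i, fun i j => rfl⟩)
      fun b j hj => hεR.trans_le (mul_le_mul_of_nonneg_left
        (le_volume_of_bar_subset (i := ⟨0, by omega⟩) hRpos
          (by rwa [Subsingleton.elim (0 : Fin 1) j])) h1.le)
    have hnR' : (n : ℝ) ≤ R := by exact_mod_cast hnR.le
    norm_num at hq
    nlinarith
  · set k := n / R with hk_def
    have hk : 0 < k := Nat.div_pos hnR hR0
    have hkn : R * k ≤ n := Nat.mul_div_le n R
    have hnk : n < 2 * (R * k) := by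
      have h2 := Nat.lt_mul_div_succ n hR0
      have h3 : R * (n / R + 1) ≤ 2 * (R * k) := by
        rw [← hk_def]
        nlinarith
      omega
    -- Blocks are residue classes modulo `k`, and the quotient `i / k` is the position of the moved
    -- square. Each block reaches the positions `0, …, R - 1`, so one active block covers area `R`.
    have hq := le_queries_of_blocks hA (k := k) (blk := fun i => ⟨i % k, Nat.mod_lt _ hk⟩)
      (v := fun i => ((i / k : ℕ) : ℝ)) (h := 1) (by omega) hk one_pos
      (fun b => ⟨fun i => isAxisAlignedPolygon_blockInstance one_pos b i, fun i j => by
        have : ∀ i : Fin n, volume (blockInstance (fun i : Fin n => ⟨i % k, Nat.mod_lt _ hk⟩)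
            (fun i => ((i / k : ℕ) : ℝ)) 1 b i) = ENNReal.ofReal 1 := by
          intro i
          unfold blockInstance
          split_ifs <;> exact volume_bar _ _
        rw [this, this]⟩)
      fun b j hj => by
        refine hεR.trans_le (mul_le_mul_of_nonneg_left ?_ h1.le)
        have hbox : volume (Ico (0 : ℝ) R ×ˢ Icc (0 : ℝ) 1) = ENNReal.ofReal R := by
          rw [Measure.volume_eq_prod, Measure.prod_prod, Real.volume_Ico, Real.volume_Icc]
          simp
        rw [← ENNReal.ofReal_le_iff_le_toReal (volume_iUnion_blockInstance_ne_top one_pos b), ← hbox]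
        refine measure_mono fun z hz => ?_
        have hs : ⌊z.1⌋₊ < R := (Nat.floor_lt hz.1.1).2 hz.1.2
        have hlt : (j : ℕ) + k * ⌊z.1⌋₊ < n := by
          have := j.isLt
          calc (j : ℕ) + k * ⌊z.1⌋₊ < k + k * ⌊z.1⌋₊ := by omega
            _ = k * (⌊z.1⌋₊ + 1) := by ring
            _ ≤ k * R := Nat.mul_le_mul_left k hs
            _ ≤ n := by rwa [mul_comm]
        refine mem_iUnion.2 ⟨⟨j + k * ⌊z.1⌋₊, hlt⟩, ?_⟩
        have hmod : (⟨((j : ℕ) + k * ⌊z.1⌋₊) % k, Nat.mod_lt _ hk⟩ : Fin k) = j :=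
          Fin.ext ((Nat.add_mul_mod_self_left _ _ _).trans (Nat.mod_eq_of_lt j.isLt))
        have hdiv : ((j : ℕ) + k * ⌊z.1⌋₊) / k = ⌊z.1⌋₊ := by
          rw [Nat.add_mul_div_left _ _ hk, Nat.div_eq_of_lt j.isLt, zero_add]
        simp only [blockInstance, hmod, hj, if_true, hdiv]
        exact mem_bar.2 ⟨hz.2.1, Nat.floor_le hz.1.1, (Nat.lt_floor_add_one z.1).le, hz.2.2⟩
    have hnk' : (n : ℝ) < 2 * (R * k) := by exact_mod_cast hnk
    nlinarith

theorem div_sq_le_of_large_error {n : ℕ} {ε : ℝ} (hε : 1 / 128 ≤ ε) :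
    (n : ℝ) / ε ^ 2 ≤ 16384 * n := by
  rw [div_le_iff₀ (by positivity)]
  have h1 : (1 / 128 : ℝ) ^ 2 ≤ ε ^ 2 := pow_le_pow_left₀ (by norm_num) hε 2
  have h2 : (0 : ℝ) ≤ n := n.cast_nonneg
  nlinarith

end UnionVolume

/-! ### Combination of the two regimes -/

theorem theorem1 :
    -- arbitrary axis-aligned polygons
    (∃ c : ℝ, 0 < c ∧ ∀ (n : ℕ) (ε : ℝ), 2 ≤ n → 0 < ε → ε < 1 →
      ∀ (Ω : Type*) [MeasurableSpace Ω] (P : Measure Ω) [IsProbabilityMeasure P]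
        (A : QueryAlgorithm Ω n) (q : ℕ),
        A.Solves P ε q (polygonInstances n) → c * (n / ε ^ 2) ≤ q) ∧
    -- axis-aligned polygons of equal area
    (∀ ε₀ : ℝ, ε₀ < 1 → ∃ c : ℝ, 0 < c ∧ ∀ (n : ℕ) (ε : ℝ), 2 ≤ n → 0 < ε → ε ≤ ε₀ →
      ∀ (Ω : Type*) [MeasurableSpace Ω] (P : Measure Ω) [IsProbabilityMeasure P]
        (A : QueryAlgorithm Ω n) (q : ℕ),
        A.Solves P ε q (equiponderousPolygonInstances n) → c * (n / ε ^ 2) ≤ q) := by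
  have weaken : ∀ {c c' : ℝ} {n q : ℕ} {ε : ℝ}, c ≤ c' → c' * (n / ε ^ 2) ≤ (q : ℝ) →
      c * (n / ε ^ 2) ≤ (q : ℝ) := fun hc h =>
    (mul_le_mul_of_nonneg_right hc (by positivity)).trans h
  -- `688128 = 42 * 16384`, and `1376256 = 84 * 16384` below: the linear bounds with `1 / ε ^ 2 ≤
  -- 128 ^ 2` inserted.
  refine ⟨⟨1 / 688128, by norm_num, ?_⟩, ?_⟩
  · intro n ε hn hε hε' Ω _ P _ A q hA
    rcases le_total ε (1 / 128) with hs | hl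
    · exact weaken (by norm_num) (UnionVolume.le_queries_of_small_error hn hε hs
        fun O hO => hA O hO.1)
    · have h1 := UnionVolume.le_queries_of_polygons hn hε hε' hA
      have h2 := UnionVolume.div_sq_le_of_large_error (n := n) hl
      linarith
  · intro ε₀ hε₀
    have h0 : 0 < 1 - ε₀ := by linarith
    obtain ⟨R, hR⟩ := exists_nat_gt ((1 + ε₀) / (1 - ε₀))
    rw [div_lt_iff₀ h0] at hR
    -- `R + 1` instead of `R` keeps the constant positive even when `R = 0`, which can happen for
    -- negative `ε₀`.
    refine ⟨1 / (1376256 * (R + 1)), by positivity, ?_⟩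
    intro n ε hn hε hε' Ω _ P _ A q hA
    have hR0 : (0 : ℝ) ≤ R := R.cast_nonneg
    rcases le_total ε (1 / 128) with hs | hl
    · refine weaken ?_ (UnionVolume.le_queries_of_small_error hn hε hs hA)
      exact one_div_le_one_div_of_le (by norm_num) (by nlinarith)
    · have h1 := UnionVolume.le_queries_of_equiponderous (R := R + 1) hn hε (by linarith)
        (by push_cast; nlinarith) hA
      have h2 := UnionVolume.div_sq_le_of_large_error (n := n) hl
      calc 1 / (1376256 * ((R : ℝ) + 1)) * (n / ε ^ 2)
          ≤ 1 / (1376256 * ((R : ℝ) + 1)) * (16384 * n) := by gcongr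
        _ = 1 / (84 * ((R + 1 : ℕ) : ℝ)) * n := by
          push_cast
          field_simp
          norm_num
        _ ≤ q := h1
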